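/- **Setting.** For a finite word $w$ and an infinite sequence $x$ in the letters $0,1$ write $w\cdot x$ for their concatenation, and let $\mathfrak C=\{0,1\}^{\mathbf N}$. A leaf of a finite rooted binary tree $t$ is identified with the word in $0$ (left edge) and $1$ (right edge) read along the path from the root to it. Thompson's group $V$ is the group of bijections $v$ of $\mathfrak C$ for which there are finite rooted binary trees $t,s$ and a bijection $b:\mathrm{Leaf}(t)\to\mathrm{Leaf}(s)$ with $v(\ell\cdot x)=b(\ell)\cdot x$ for all $\ell\in\mathrm{Leaf}(t)$, $x\in\mathfrak C$. Let $\Gamma$ be a group and $\alpha_0,\alpha_1\in\mathrm{End}(\Gamma)$; for a word $m=m_1\cdots m_k$ put $\alpha_m=\alpha_{m_k}\circ\cdots\circ\alpha_{m_1}$. For a tree $t$ let $\Gamma_t=\Gamma^{\mathrm{Leaf}(t)}$. If the tree $s$ is obtained from $t$ by attaching a tree to each leaf of $t$, let $\Gamma_t\to\Gamma_s$ be the morphism that sends $(g_\ell)_\ell$ to the family whose value at the leaf $\ell\cdot m$ of $s$ (with $\ell\in\mathrm{Leaf}(t)$) is $\alpha_m(g_\ell)$. Let $K=\varinjlim_t\Gamma_t$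 be the direct limit over all trees. The Jones action of $V$ on $K$ by automorphisms is given by $v\cdot[g]=[g\circ b^{-1}]$, for $v$ given by $(t,s,b)$ as above and $g\in\Gamma_t$ (every element of $K$ has a representative in $\Gamma_t$ for such a $t$). The semidirect product $K\rtimes V$ is the fraction group of the triple $(\Gamma,\alpha_0,\alpha_1)$. A morphism between two such limit groups is $V$-equivariant if it intertwines the Jones actions. **Theorem B.** Let $\Gamma,\Lambda$ be groups, let $\alpha\in\mathrm{End}(\Gamma)$, and let $\beta_0,\beta_1\in\mathrm{End}(\Lambda)$ be injective. Let $K\rtimes V$ and $L\rtimes V$ be the fraction groups of the triples $(\Gamma,\alpha,\varepsilon_\Gamma)$ and $(\Lambda,\beta_0,\beta_1)$ respectively, where $\varepsilon_\Gamma$ is the trivial endomorphism of $\Gamma$. 1. If $K$ or $L$ is nontrivial, then there is no isomorphism between the groups $K\rtimes V$ and $L\rtimes V$. 2. If $L$ is nontrivial, then there is no injective $V$-equivariant morphism from $L$ to $K$. 3. Every $V$-equivariant morphism $\theta:K\to L$ takes values in the $V$-invariant elements of $L$, that is, $v\cdot\theta(a)=\theta(a)$ for all $v\in V$, $a\in K$;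 and if $K$ is nontrivial, then there is no injective $V$-equivariant morphism from $K$ to $L$. -/

import Mathlib

noncomputable section

namespace FractionGroups

/-- The Cantor space of infinite binary sequences. -/
abbrev Cantor : Type := ℕ → Bool

/-- The concatenation `w · x` of a finite word with an infinite sequence. -/
def cat : List Bool → Cantor → Cantor
  | [], x => x
  | a :: w, x => fun n => Nat.casesOn n a (cat w x)

/-- Finite rooted ordered binary trees. -/
inductive BTree : Type
  | leaf : BTree
  | node : BTree → BTree → BTree

namespace BTree

/-- `t.IsLeaf w` : the word `w` is the path from the root of `t` to one of its leaves, where `false`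
(the letter `0`) is a left edge and `true` (the letter `1`) a right edge. -/
def IsLeaf : BTree → List Bool → Prop
  | leaf, [] => True
  | leaf, _ :: _ => False
  | node _ _, [] => False
  | node a _, false :: w => a.IsLeaf w
  | node _ b, true :: w => b.IsLeaf w

/-- The leaves of a tree. The leaf `w` is also the standard dyadic interval of all the sequences
with prefix `w`, and the leaves of a tree form a standard dyadic partition of the Cantor space. -/
abbrev Leaf (t : BTree) : Type := {w : List Bool // t.IsLeaf w}

/-- The composition `f ∘ t` of a forest with a tree: the tree `f w` is attached to each leaf `w`
of `t` (the values of `f` at the other words play no role). -/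
def graft : BTree → (List Bool → BTree) → BTree
  | leaf, f => f []
  | node a b, f => node (a.graft fun w => f (false :: w)) (b.graft fun w => f (true :: w))

theorem graft_leaf (t : BTree) : t.graft (fun _ => leaf) = t := by
  induction t with
  | leaf => rfl
  | node a b iha ihb => simp [graft, iha, ihb]

theorem graft_graft (t : BTree) (f g : List Bool → BTree) :
    (t.graft f).graft g = t.graft fun w => (f w).graft fun u => g (w ++ u) := by
  induction t generalizing f g with
  | leaf => rfl
  | node a b iha ihb => simp [graft, iha, ihb]

/-- `t ≤ s` when `s = f ∘ t` for some forest `f`. -/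
instance : Preorder BTree where
  le t s := ∃ f, s = t.graft f
  le_refl t := ⟨_, (graft_leaf t).symm⟩
  le_trans := by
    rintro a _ _ ⟨f, rfl⟩ ⟨g, rfl⟩
    exact ⟨_, graft_graft a f g⟩

theorem exists_common (t s : BTree) : ∃ f g, t.graft f = s.graft g := by
  induction t generalizing s with
  | leaf => exact ⟨fun _ => s, fun _ => leaf, (graft_leaf s).symm⟩
  | node a b iha ihb =>
    cases s with
    | leaf => exact ⟨fun _ => leaf, fun _ => node a b, graft_leaf _⟩
    | node c d =>
      obtain ⟨f, g, h⟩ := iha c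
      obtain ⟨f', g', h'⟩ := ihb d
      refine ⟨fun w => match w with
        | [] => leaf
        | false :: u => f u
        | true :: u => f' u, fun w => match w with
        | [] => leaf
        | false :: u => g u
        | true :: u => g' u, ?_⟩
      simp [graft, h, h']

instance : Nonempty BTree := ⟨leaf⟩

instance : IsDirectedOrder BTree where
  directed t s := by
    obtain ⟨f, g, h⟩ := exists_common t s
    exact ⟨t.graft f, ⟨f, rfl⟩, ⟨g, h⟩⟩

theorem isLeaf_graft (t : BTree) (f : List Bool → BTree) (w : List Bool) :
    (t.graft f).IsLeaf w ↔ ∃ p m, t.IsLeaf p ∧ (f p).IsLeaf m ∧ w = p ++ m := by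
  induction t generalizing f w with
  | leaf =>
    constructor
    · intro h
      exact ⟨[], w, trivial, h, rfl⟩
    · rintro ⟨p, m, hp, hm, rfl⟩
      cases p with
      | nil => exact hm
      | cons a p => exact hp.elim
  | node a b iha ihb =>
    constructor
    · intro h
      match w, h with
      | false :: w, h =>
        obtain ⟨p, m, hp, hm, rfl⟩ := (iha _ _).1 h
        exact ⟨false :: p, m, hp, hm, rfl⟩
      | true :: w, h =>
        obtain ⟨p, m, hp, hm, rfl⟩ := (ihb _ _).1 h
        exact ⟨true :: p, m, hp, hm, rfl⟩
    · rintro ⟨p, m, hp, hm, rfl⟩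
      match p, hp, hm with
      | false :: p, hp, hm => exact (iha _ _).2 ⟨p, m, hp, hm, rfl⟩
      | true :: p, hp, hm => exact (ihb _ _).2 ⟨p, m, hp, hm, rfl⟩

theorem isLeaf_unique (t : BTree) {p q m n : List Bool} (hp : t.IsLeaf p) (hq : t.IsLeaf q)
    (h : p ++ m = q ++ n) : p = q ∧ m = n := by
  induction t generalizing p q with
  | leaf =>
    cases p with
    | nil =>
      cases q with
      | nil => exact ⟨rfl, h⟩
      | cons => exact hq.elim
    | cons => exact hp.elim
  | node a b iha ihb =>
    match p, q, hp, hq, h with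
    | false :: p, false :: q, hp, hq, h =>
      obtain ⟨rfl, rfl⟩ := iha hp hq (List.cons.inj h).2
      exact ⟨rfl, rfl⟩
    | true :: p, true :: q, hp, hq, h =>
      obtain ⟨rfl, rfl⟩ := ihb hp hq (List.cons.inj h).2
      exact ⟨rfl, rfl⟩
    | false :: p, true :: q, hp, hq, h => simp at h
    | true :: p, false :: q, hp, hq, h => simp at h

theorem exists_prefix {t s : BTree} (h : t ≤ s) (q : s.Leaf) :
    ∃ (p : t.Leaf) (m : List Bool), q.1 = p.1 ++ m := by
  obtain ⟨f, rfl⟩ := h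
  obtain ⟨p, m, hp, -, hq⟩ := (isLeaf_graft t f q.1).1 q.2
  exact ⟨⟨p, hp⟩, m, hq⟩

/-- For `s = f ∘ t`, the leaf of `t` below which a given leaf of `s` lies. -/
def parent {t s : BTree} (h : t ≤ s) (q : s.Leaf) : t.Leaf := (exists_prefix h q).choose

/-- For `s = f ∘ t`, the path in the tree `f_ℓ` from its root (a leaf `ℓ` of `t`) to a given leaf
of `s`. -/
def path {t s : BTree} (h : t ≤ s) (q : s.Leaf) : List Bool := (exists_prefix h q).choose_spec.choose

theorem parent_append_path {t s : BTree} (h : t ≤ s) (q : s.Leaf) :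
    q.1 = (parent h q).1 ++ path h q := (exists_prefix h q).choose_spec.choose_spec

theorem parent_path_eq {t s : BTree} (h : t ≤ s) (q : s.Leaf) (p : t.Leaf) (m : List Bool)
    (hq : q.1 = p.1 ++ m) : parent h q = p ∧ path h q = m := by
  obtain ⟨h1, h2⟩ := isLeaf_unique t (parent h q).2 p.2 ((parent_append_path h q).symm.trans hq)
  exact ⟨Subtype.ext h1, h2⟩

end BTree

open BTree

theorem cat_append (u w : List Bool) (x : Cantor) : cat (u ++ w) x = cat u (cat w x) := by
  induction u with
  | nil => rfl
  | cons a u ih => simp [cat, ih]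

theorem cat_cons_inj {a b : Bool} {u w : List Bool} {x y : Cantor}
    (h : cat (a :: u) x = cat (b :: w) y) : a = b ∧ cat u x = cat w y :=
  ⟨congrFun h 0, funext fun n => congrFun h (n + 1)⟩

theorem cat_left_injective {u w : List Bool} (h : ∀ x, cat u x = cat w x) : u = w := by
  induction u generalizing w with
  | nil =>
    cases w with
    | nil => rfl
    | cons a w =>
      have := congrFun (h fun _ => !a) 0
      simp [cat] at this
  | cons a u ih =>
    cases w with
    | nil =>
      have := congrFun (h fun _ => !a) 0
      simp [cat] at this
    | cons b w =>
      have hab := (cat_cons_inj (h fun _ => true)).1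
      subst hab
      rw [ih fun x => (cat_cons_inj (h x)).2]

/-- `v` is the bijection of the Cantor space that carries the standard dyadic partition of `t` onto
that of `s` along the bijection `b` between their leaves: `v (ℓ · x) = b ℓ · x`. -/
def Carries (v : Equiv.Perm Cantor) (t s : BTree) (b : t.Leaf ≃ s.Leaf) : Prop :=
  ∀ (l : t.Leaf) (x : Cantor), v (cat l.1 x) = cat (b l).1 x

theorem Carries.symm {v : Equiv.Perm Cantor} {t s : BTree} {b : t.Leaf ≃ s.Leaf}
    (h : Carries v t s b) : Carries v⁻¹ s t b.symm := by
  intro l x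
  rw [Equiv.Perm.inv_eq_iff_eq, h, Equiv.apply_symm_apply]

theorem Carries.mul {v w : Equiv.Perm Cantor} {r s t : BTree} {b : r.Leaf ≃ s.Leaf}
    {c : s.Leaf ≃ t.Leaf} (hv : Carries v r s b) (hw : Carries w s t c) :
    Carries (w * v) r t (b.trans c) := by
  intro l x
  rw [Equiv.Perm.mul_apply, hv, hw, Equiv.trans_apply]

theorem Carries.one (t : BTree) : Carries 1 t t (Equiv.refl _) := fun _ _ => rfl

/-- A bijection carrying `t` to `s` carries each refinement of `t` to a refinement of `s`. -/
theorem Carries.refine {v : Equiv.Perm Cantor} {t s u : BTree} {b : t.Leaf ≃ s.Leaf}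
    (h : Carries v t s b) (htu : t ≤ u) :
    ∃ (r : BTree) (_ : s ≤ r) (c : u.Leaf ≃ r.Leaf), Carries v u r c ∧
      ∀ q : u.Leaf, (c q).1 = (b (parent htu q)).1 ++ path htu q := by
  classical
  obtain ⟨f, hf⟩ := id htu
  let g : List Bool → BTree := fun w => if hw : s.IsLeaf w then f (b.symm ⟨w, hw⟩).1 else leaf
  have hg : ∀ p : t.Leaf, g (b p).1 = f p.1 := by
    intro p
    have : (⟨(b p).1, (b p).2⟩ : s.Leaf) = b p := rfl
    simp only [g, dif_pos (b p).2, this, Equiv.symm_apply_apply]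
  have hmem : ∀ (p : t.Leaf) (m : List Bool), u.IsLeaf (p.1 ++ m) → (f p.1).IsLeaf m := by
    intro p m hm
    rw [hf, isLeaf_graft] at hm
    obtain ⟨p', m', hp', hm', he⟩ := hm
    obtain ⟨rfl, rfl⟩ := isLeaf_unique t p.2 hp' he
    exact hm'
  have hto : ∀ q : u.Leaf, (s.graft g).IsLeaf ((b (parent htu q)).1 ++ path htu q) := by
    intro q
    refine (isLeaf_graft _ _ _).2 ⟨_, _, (b _).2, ?_, rfl⟩
    rw [hg]
    apply hmem
    rw [← parent_append_path]
    exact q.2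
  let c : u.Leaf → (s.graft g).Leaf := fun q => ⟨_, hto q⟩
  have hc : Function.Bijective c := by
    constructor
    · intro q q' he
      obtain ⟨h1, h2⟩ := isLeaf_unique s (b (parent htu q)).2 (b (parent htu q')).2
        (congrArg Subtype.val he)
      have h3 := b.injective (Subtype.ext h1)
      apply Subtype.ext
      rw [parent_append_path htu q, parent_append_path htu q', h2, h3]
    · intro r
      obtain ⟨p, m, hp, hm, he⟩ := (isLeaf_graft s g r.1).1 r.2
      obtain ⟨l, hl⟩ := b.surjective ⟨p, hp⟩
      have hpl : (b l).1 = p := congrArg Subtype.val hl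
      rw [← hpl, hg] at hm
      have hu : u.IsLeaf (l.1 ++ m) := by
        rw [hf]
        exact (isLeaf_graft _ _ _).2 ⟨_, _, l.2, hm, rfl⟩
      obtain ⟨h1, h2⟩ := parent_path_eq htu ⟨_, hu⟩ l m rfl
      refine ⟨⟨_, hu⟩, Subtype.ext ?_⟩
      change (b (parent htu ⟨_, hu⟩)).1 ++ path htu ⟨_, hu⟩ = r.1
      rw [h1, h2, hpl, he]
  refine ⟨s.graft g, ⟨g, rfl⟩, Equiv.ofBijective c hc, ?_, fun q => rfl⟩
  intro q x
  change v (cat q.1 x) = cat ((b (parent htu q)).1 ++ path htu q) x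
  rw [parent_append_path htu q, cat_append, h, cat_append]

/-- Thompson's group `V`: the bijections (in fact homeomorphisms) of the Cantor space that carry
one standard dyadic partition onto another by exchanging prefixes. -/
def ThompsonV : Subgroup (Equiv.Perm Cantor) where
  carrier := {v | ∃ (t s : BTree) (b : t.Leaf ≃ s.Leaf), Carries v t s b}
  one_mem' := ⟨leaf, leaf, _, Carries.one leaf⟩
  inv_mem' := by
    rintro v ⟨t, s, b, h⟩
    exact ⟨s, t, b.symm, h.symm⟩
  mul_mem' := by
    rintro w v ⟨t', s', b', hw⟩ ⟨t, s, b, hv⟩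
    obtain ⟨u, hsu, htu⟩ := exists_ge_ge s t'
    obtain ⟨r, -, c, hc, -⟩ := hv.symm.refine hsu
    obtain ⟨r', -, c', hc', -⟩ := hw.refine htu
    rw [inv_inv v |>.symm]
    exact ⟨r, r', _, hc.symm.mul hc'⟩

section Limit

variable {Γ : Type*} [Group Γ] (α₀ α₁ : Γ →* Γ)

/-- `α_m = α_{m_k} ∘ ⋯ ∘ α_{m_1}` for a word `m = m_1 ⋯ m_k`. -/
def wordEnd : List Bool → Γ →* Γ
  | [] => MonoidHom.id Γ
  | a :: m => (wordEnd m).comp (bif a then α₁ else α₀)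

theorem wordEnd_append (u w : List Bool) (g : Γ) :
    wordEnd α₀ α₁ (u ++ w) g = wordEnd α₀ α₁ w (wordEnd α₀ α₁ u g) := by
  induction u generalizing g with
  | nil => rfl
  | cons a u ih => simp [wordEnd, ih]

/-- The map `Φ(f) : Γ_t → Γ_{f ∘ t}`, where `Γ_t` is the group of maps from the leaves of `t` to
`Γ`, and `Φ` is the monoidal functor with `Φ(1) = Γ` and `Φ(Y) = (α₀, α₁)`: below the leaf `ℓ` of
`t`, the value at the leaf of `f_ℓ` with path `m` is `α_m (g ℓ)`. -/
def transition (t s : BTree) (h : t ≤ s) : (t.Leaf → Γ) →* (s.Leaf → Γ) where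
  toFun g q := wordEnd α₀ α₁ (path h q) (g (parent h q))
  map_one' := by funext q; simp
  map_mul' g g' := by funext q; simp

theorem transition_apply {t s : BTree} (h : t ≤ s) (g : t.Leaf → Γ) (q : s.Leaf) (p : t.Leaf)
    (m : List Bool) (hq : q.1 = p.1 ++ m) :
    transition α₀ α₁ t s h g q = wordEnd α₀ α₁ m (g p) := by
  obtain ⟨h1, h2⟩ := parent_path_eq h q p m hq
  simp [transition, h1, h2]

instance : DirectedSystem (fun t : BTree => t.Leaf → Γ) (transition α₀ α₁ · · ·) where
  map_self t g := by
    funext q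
    exact transition_apply α₀ α₁ _ g q q [] (by simp)
  map_map r s t hts hsr g := by
    funext q
    have h1 := parent_append_path hsr q
    have h2 := parent_append_path hts (parent hsr q)
    rw [transition_apply α₀ α₁ hsr _ q _ _ h1, transition_apply α₀ α₁ hts g _ _ _ h2,
      transition_apply α₀ α₁ (hts.trans hsr) g q (parent hts (parent hsr q))
        (path hts (parent hsr q) ++ path hsr q) (by rw [← List.append_assoc, ← h2, ← h1]),
      wordEnd_append]

/-- The limit group `K = lim Γ_t` over all trees `t`. -/
abbrev LimitGroup : Type _ := DirectLimit (fun t : BTree => t.Leaf → Γ) (transition α₀ α₁)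

/-- The class in the limit group of an element of `Γ_t`. -/
def cls {t : BTree} (g : t.Leaf → Γ) : LimitGroup α₀ α₁ := ⟦⟨t, g⟩⟧

theorem cls_transition {t s : BTree} (h : t ≤ s) (g : t.Leaf → Γ) :
    cls α₀ α₁ (transition α₀ α₁ t s h g) = cls α₀ α₁ g :=
  DirectLimit.mk_apply (F := fun t : BTree => t.Leaf → Γ) (f := transition α₀ α₁) t s g h

theorem cls_mul {t : BTree} (g g' : t.Leaf → Γ) :
    cls α₀ α₁ (g * g') = cls α₀ α₁ g * cls α₀ α₁ g' :=
  (DirectLimit.mul_def (G := fun t : BTree => t.Leaf → Γ) (f := transition α₀ α₁) t g g').symm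

theorem cls_eq {t s : BTree} {g : t.Leaf → Γ} {h : s.Leaf → Γ} :
    cls α₀ α₁ g = cls α₀ α₁ h ↔ ∃ (u : BTree) (hx : t ≤ u) (hy : s ≤ u),
      transition α₀ α₁ t u hx g = transition α₀ α₁ s u hy h :=
  Quotient.eq

/-- A refinement of a pair of partitions computes the same transported element. -/
theorem Carries.refine_cls {v : Equiv.Perm Cantor} {t s u : BTree} {b : t.Leaf ≃ s.Leaf}
    (h : Carries v t s b) (htu : t ≤ u) :
    ∃ (r : BTree) (_ : s ≤ r) (c : u.Leaf ≃ r.Leaf), Carries v u r c ∧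
      ∀ g : t.Leaf → Γ, cls α₀ α₁ (transition α₀ α₁ t u htu g ∘ c.symm) =
        cls α₀ α₁ (g ∘ b.symm) := by
  obtain ⟨r, hr, c, hc, hcq⟩ := h.refine htu
  refine ⟨r, hr, c, hc, fun g => ?_⟩
  rw [← cls_transition α₀ α₁ hr (g ∘ b.symm)]
  congr 1
  funext q
  obtain ⟨l, rfl⟩ := c.surjective q
  rw [transition_apply α₀ α₁ hr _ _ _ _ (hcq l)]
  simp [transition]

/-- The transported element does not depend on the chosen representatives. -/
theorem cls_transport_congr {v : Equiv.Perm Cantor} {t s t' s' : BTree} {b : t.Leaf ≃ s.Leaf}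
    {b' : t'.Leaf ≃ s'.Leaf} (h : Carries v t s b) (h' : Carries v t' s' b')
    {g : t.Leaf → Γ} {g' : t'.Leaf → Γ} (hg : cls α₀ α₁ g = cls α₀ α₁ g') :
    cls α₀ α₁ (g ∘ b.symm) = cls α₀ α₁ (g' ∘ b'.symm) := by
  obtain ⟨u, hx, hy, he⟩ := (cls_eq α₀ α₁).1 hg
  obtain ⟨r, -, c, hc, hcg⟩ := h.refine_cls α₀ α₁ hx
  obtain ⟨r', -, c', hc', hcg'⟩ := h'.refine_cls α₀ α₁ hy
  rw [← hcg, ← hcg', he]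
  have hcc : ∀ l : u.Leaf, (c l).1 = (c' l).1 := fun l =>
    cat_left_injective fun x => (hc l x).symm.trans (hc' l x)
  obtain ⟨w, hw, hw'⟩ := exists_ge_ge r r'
  rw [cls_eq]
  refine ⟨w, hw, hw', ?_⟩
  funext q
  obtain ⟨l, hl⟩ := c.surjective (parent hw q)
  have hq := parent_append_path hw q
  rw [← hl] at hq
  rw [transition_apply α₀ α₁ hw _ q _ _ hq,
    transition_apply α₀ α₁ hw' _ q (c' l) _ (by rw [← hcc]; exact hq)]
  simp

theorem exists_rep (v : ThompsonV) (k k' : LimitGroup α₀ α₁) :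
    ∃ (t s : BTree) (b : t.Leaf ≃ s.Leaf) (g g' : t.Leaf → Γ),
      Carries v.1 t s b ∧ k = cls α₀ α₁ g ∧ k' = cls α₀ α₁ g' := by
  obtain ⟨t, s, b, h⟩ := v.2
  obtain ⟨r, g, g', rfl, rfl⟩ := DirectLimit.exists_eq_mk₂ (transition α₀ α₁) k k'
  obtain ⟨u, htu, hru⟩ := exists_ge_ge t r
  obtain ⟨r', -, c, hc, -⟩ := h.refine htu
  exact ⟨u, r', c, _, _, hc, (cls_transition α₀ α₁ hru g).symm,
    (cls_transition α₀ α₁ hru g').symm⟩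

/-- `k'` is the image of `k` under `v` for the Jones action: `k` is the class of some
`g ∈ Γ_t`, where `v` is given by the trees `t`, `s` and the bijection `b` between their leaves,
and `k'` is the class of `g ∘ b⁻¹ ∈ Γ_s`. -/
def JonesRel (v : ThompsonV) (k k' : LimitGroup α₀ α₁) : Prop :=
  ∃ (t s : BTree) (b : t.Leaf ≃ s.Leaf) (g : t.Leaf → Γ),
    Carries v.1 t s b ∧ k = cls α₀ α₁ g ∧ k' = cls α₀ α₁ (g ∘ b.symm)

theorem exists_jonesRel (v : ThompsonV) (k : LimitGroup α₀ α₁) : ∃ k', JonesRel α₀ α₁ v k k' := by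
  obtain ⟨t, s, b, g, -, h, hk, -⟩ := exists_rep α₀ α₁ v k k
  exact ⟨_, t, s, b, g, h, hk, rfl⟩

/-- The Jones action, as a map. -/
def jonesFun (v : ThompsonV) (k : LimitGroup α₀ α₁) : LimitGroup α₀ α₁ :=
  (exists_jonesRel α₀ α₁ v k).choose

theorem jonesFun_cls (v : ThompsonV) {t s : BTree} {b : t.Leaf ≃ s.Leaf}
    (h : Carries v.1 t s b) (g : t.Leaf → Γ) :
    jonesFun α₀ α₁ v (cls α₀ α₁ g) = cls α₀ α₁ (g ∘ b.symm) := by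
  obtain ⟨t', s', b', g', h', hk, hk'⟩ := (exists_jonesRel α₀ α₁ v (cls α₀ α₁ g)).choose_spec
  exact hk'.trans (cls_transport_congr α₀ α₁ h' h hk.symm)

theorem jonesFun_map_mul (v : ThompsonV) (k k' : LimitGroup α₀ α₁) :
    jonesFun α₀ α₁ v (k * k') = jonesFun α₀ α₁ v k * jonesFun α₀ α₁ v k' := by
  obtain ⟨t, s, b, g, g', h, rfl, rfl⟩ := exists_rep α₀ α₁ v k k'
  rw [← cls_mul, jonesFun_cls α₀ α₁ v h, jonesFun_cls α₀ α₁ v h, jonesFun_cls α₀ α₁ v h, ← cls_mul]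
  rfl

theorem jonesFun_one (k : LimitGroup α₀ α₁) : jonesFun α₀ α₁ 1 k = k := by
  obtain ⟨t, g, rfl⟩ := DirectLimit.exists_eq_mk (transition α₀ α₁) k
  exact jonesFun_cls α₀ α₁ 1 (Carries.one t) g

theorem jonesFun_mul (w v : ThompsonV) (k : LimitGroup α₀ α₁) :
    jonesFun α₀ α₁ (w * v) k = jonesFun α₀ α₁ w (jonesFun α₀ α₁ v k) := by
  obtain ⟨t, s, b, g, -, hv, rfl, -⟩ := exists_rep α₀ α₁ v k k
  obtain ⟨t', s', b', hw⟩ := w.2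
  obtain ⟨u, hsu, htu⟩ := exists_ge_ge s t'
  obtain ⟨r, hr, c, hc, -⟩ := hv.symm.refine hsu
  obtain ⟨r', -, c', hc', -⟩ := hw.refine htu
  have hc2 : Carries v.1 r u c.symm := by simpa using hc.symm
  have hm : Carries (w * v).1 r r' (c.symm.trans c') := hc2.mul hc'
  rw [← cls_transition α₀ α₁ hr g, jonesFun_cls α₀ α₁ _ hm, jonesFun_cls α₀ α₁ _ hc2,
    jonesFun_cls α₀ α₁ _ hc']
  rfl

/-- The Jones action `V ↷ K` of the triple `(Γ, α₀, α₁)`, by group automorphisms. -/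
def jonesAction : ThompsonV →* MulAut (LimitGroup α₀ α₁) where
  toFun v :=
    { toFun := jonesFun α₀ α₁ v
      invFun := jonesFun α₀ α₁ v⁻¹
      left_inv := fun k => by rw [← jonesFun_mul, inv_mul_cancel, jonesFun_one]
      right_inv := fun k => by rw [← jonesFun_mul, mul_inv_cancel, jonesFun_one]
      map_mul' := jonesFun_map_mul α₀ α₁ v }
  map_one' := MulEquiv.ext (jonesFun_one α₀ α₁)
  map_mul' w v := MulEquiv.ext (jonesFun_mul α₀ α₁ w v)

/-- The fraction group `K ⋊ V` of the triple `(Γ, α₀, α₁)`. -/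
abbrev FractionGroup : Type _ := LimitGroup α₀ α₁ ⋊[jonesAction α₀ α₁] ThompsonV

end Limit

/-- A morphism between the limit groups of two triples is `V`-equivariant if it intertwines the
Jones actions. -/
def IsEquivariant {Γ Λ : Type*} [Group Γ] [Group Λ] {α₀ α₁ : Γ →* Γ} {β₀ β₁ : Λ →* Λ}
    (θ : LimitGroup α₀ α₁ →* LimitGroup β₀ β₁) : Prop :=
  ∀ (v : ThompsonV) (a : LimitGroup α₀ α₁),
    θ (jonesAction α₀ α₁ v a) = jonesAction β₀ β₁ v (θ a)

end FractionGroups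

end

/-
An element of a limit group propagates to a function on all long words, and it is determined by
the germs at infinity of this function below the words of a given length; the Jones action moves
these restrictions along with the cones of the Cantor space. In particular the swap of two
disjoint cones fixes an element exactly if it has the same restriction to both.

The subgroups of `K` of the elements that are trivial below `0` and below `1` commute, they
generate `K` and they are conjugate. Under an epimorphism `K ⋊ V → V` they become commuting
subgroups normalized by the normal image of `K`. If they were nontrivial, each would contain all
swaps inside some cone, since `V` contains enough elements that displace a cone, and they would
not commute. So `K` lies in the kernel, and an isomorphism `K ⋊ V ≃ L ⋊ V` maps `K` onto `L` and
induces an automorphism of `V`.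

If some composite of `α₀` and `α₁` is trivial, then every element of `K` is trivial below some
refinement of every word, so its stabilizer contains the swaps inside small cones everywhere. With
`β₀` and `β₁` injective, `L` has an element that is nontrivial below each word in the half `0` and
trivial in the half `1`, so the elements of `V` that fix it up to conjugacy preserve both halves.
The pointwise stabilizers of the halves commute and, pulled back along the automorphism of `V`,
are normalized by the stabilizer of the corresponding element of `K`; the argument above shows
again that they cannot commute. Equivariant morphisms respect equality of the restrictions to
disjoint cones, which gives the other two claims.
-/

noncomputable section

namespace FractionGroups

open BTree Filter
open scoped Pointwise commutatorElement

section Words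

theorem cat_apply_of_lt {w : List Bool} {i : ℕ} (hi : i < w.length) (x : Cantor) :
    cat w x i = w[i] := by
  induction w generalizing i with
  | nil => simp at hi
  | cons a w ih =>
    cases i with
    | zero => rfl
    | succ i => exact ih (by simpa using hi)

theorem cat_injective (w : List Bool) : Function.Injective (cat w) := by
  intro x y h
  induction w with
  | nil => exact h
  | cons a w ih => exact ih (cat_cons_inj h).2

theorem exists_cat_eq (n : ℕ) (x : Cantor) : ∃ w y, w.length = n ∧ cat w y = x := by
  induction n generalizing x with
  | zero => exact ⟨[], x, rfl, rfl⟩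
  | succ n ih =>
    obtain ⟨w, y, hw, hy⟩ := ih fun i => x (i + 1)
    refine ⟨x 0 :: w, y, by simp [hw], funext fun i => ?_⟩
    cases i with
    | zero => rfl
    | succ i => exact congrFun hy i

theorem isPrefix_of_cat_eq {p q : List Bool} {x y : Cantor} (h : cat p x = cat q y)
    (hpq : p.length ≤ q.length) : p <+: q := by
  rw [List.prefix_iff_getElem]
  refine ⟨hpq, fun i hi => ?_⟩
  rw [← cat_apply_of_lt hi x, h, cat_apply_of_lt (hi.trans_le hpq)]

/-- The standard dyadic interval of the sequences that start with `w`. -/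
def cone (w : List Bool) : Set Cantor := Set.range (cat w)

theorem cat_mem_cone (w : List Bool) (x : Cantor) : cat w x ∈ cone w := ⟨x, rfl⟩

theorem cone_anti {p q : List Bool} (h : p <+: q) : cone q ⊆ cone p := by
  obtain ⟨m, rfl⟩ := h
  rintro _ ⟨x, rfl⟩
  exact ⟨cat m x, (cat_append p m x).symm⟩

theorem cat_mem_cone_iff {p q : List Bool} {x : Cantor} (h : p.length ≤ q.length) :
    cat q x ∈ cone p ↔ p <+: q :=
  ⟨fun ⟨_, hy⟩ => isPrefix_of_cat_eq hy h, fun hpq => cone_anti hpq (cat_mem_cone q x)⟩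

theorem disjoint_cone_iff {p q : List Bool} :
    Disjoint (cone p) (cone q) ↔ ¬ p <+: q ∧ ¬ q <+: p := by
  constructor
  · intro h
    exact ⟨fun hpq => Set.disjoint_left.1 h (cone_anti hpq (cat_mem_cone q 0)) (cat_mem_cone q 0),
      fun hqp => Set.disjoint_left.1 h (cat_mem_cone p 0) (cone_anti hqp (cat_mem_cone p 0))⟩
  · rintro ⟨hpq, hqp⟩
    rw [Set.disjoint_left]
    rintro _ ⟨x, rfl⟩ ⟨y, hy⟩
    rcases le_total p.length q.length with h | h
    · exact hpq (isPrefix_of_cat_eq hy.symm h)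
    · exact hqp (isPrefix_of_cat_eq hy h)

theorem disjoint_cone_append {p q : List Bool} (h : Disjoint (cone p) (cone q)) (u w : List Bool) :
    Disjoint (cone (p ++ u)) (cone (q ++ w)) :=
  h.mono (cone_anti (p.prefix_append u)) (cone_anti (q.prefix_append w))

theorem disjoint_cone_append_left_iff {p u w : List Bool} :
    Disjoint (cone (p ++ u)) (cone (p ++ w)) ↔ Disjoint (cone u) (cone w) := by
  simp only [disjoint_cone_iff, List.prefix_append_right_inj]

theorem disjoint_cone_false_true : Disjoint (cone [false]) (cone [true]) := by
  simp [disjoint_cone_iff]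

theorem cone_eq_union (p : List Bool) : cone p = cone (p ++ [false]) ∪ cone (p ++ [true]) := by
  refine Set.Subset.antisymm ?_
    (Set.union_subset (cone_anti (p.prefix_append _)) (cone_anti (p.prefix_append _)))
  rintro _ ⟨x, rfl⟩
  obtain ⟨w, y, hw, rfl⟩ := exists_cat_eq 1 x
  obtain ⟨b, rfl⟩ := List.length_eq_one_iff.1 hw
  rw [← cat_append]
  cases b
  · exact .inl (cat_mem_cone _ y)
  · exact .inr (cat_mem_cone _ y)

/-- The filter of the sets of words that contain all sufficiently long words. -/
def longWords : Filter (List Bool) := comap List.length atTop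

theorem eventually_longWords {P : List Bool → Prop} :
    (∀ᶠ w in longWords, P w) ↔ ∃ n, ∀ w : List Bool, n ≤ w.length → P w := by
  simp only [longWords, eventually_comap, eventually_atTop]
  exact ⟨fun ⟨n, h⟩ => ⟨n, fun w hw => h _ hw w rfl⟩,
    fun ⟨n, h⟩ => ⟨n, fun _ hb w hw => h w (hw ▸ hb)⟩⟩

theorem eventually_length_ge (n : ℕ) : ∀ᶠ w in longWords, n ≤ w.length :=
  eventually_longWords.2 ⟨n, fun _ => id⟩

theorem tendsto_append_longWords (w : List Bool) :
    Tendsto (w ++ ·) longWords longWords := by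
  refine tendsto_comap_iff.2 (tendsto_atTop_mono (fun m => ?_) tendsto_comap)
  simp

instance : NeBot longWords :=
  ⟨fun h => by
    obtain ⟨n, hn⟩ := eventually_longWords.1 (h ▸ eventually_bot : ∀ᶠ _ in longWords, False)
    exact hn (List.replicate n true) (by simp)⟩

theorem eventually_longWords_iff_cons {P : List Bool → Prop} :
    (∀ᶠ w in longWords, P w) ↔ ∀ b, ∀ᶠ w in longWords, P (b :: w) := by
  refine ⟨fun h b => (tendsto_append_longWords [b]).eventually h, fun h => ?_⟩
  obtain ⟨m, hm⟩ := eventually_longWords.1 (h false)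
  obtain ⟨n, hn⟩ := eventually_longWords.1 (h true)
  refine eventually_longWords.2 ⟨max m n + 1, fun w hw => ?_⟩
  match w, hw with
  | false :: w, hw => exact hm w (by simp at hw; omega)
  | true :: w, hw => exact hn w (by simp at hw; omega)

end Words

namespace BTree

theorem eventually_exists_leaf_isPrefix (t : BTree) :
    ∀ᶠ w in longWords, ∃ l : t.Leaf, l.1 <+: w := by
  induction t with
  | leaf => exact .of_forall fun w => ⟨⟨[], trivial⟩, List.nil_prefix⟩
  | node a b iha ihb =>
    refine eventually_longWords_iff_cons.2 fun c => ?_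
    cases c
    · exact iha.mono fun w ⟨l, hl⟩ => ⟨⟨false :: l.1, l.2⟩, List.cons_prefix_cons.2 ⟨rfl, hl⟩⟩
    · exact ihb.mono fun w ⟨l, hl⟩ => ⟨⟨true :: l.1, l.2⟩, List.cons_prefix_cons.2 ⟨rfl, hl⟩⟩

theorem exists_leaf_length_ge (n : ℕ) : ∃ t : BTree, ∀ w, t.IsLeaf w → n ≤ w.length := by
  induction n with
  | zero => exact ⟨leaf, fun _ _ => Nat.zero_le _⟩
  | succ n ih =>
    obtain ⟨t, ht⟩ := ih
    refine ⟨node t t, fun w hw => ?_⟩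
    match w, hw with
    | false :: w, hw => exact Nat.succ_le_succ (ht w hw)
    | true :: w, hw => exact Nat.succ_le_succ (ht w hw)

theorem exists_isLeaf (w : List Bool) : ∃ t : BTree, t.IsLeaf w := by
  induction w with
  | nil => exact ⟨leaf, trivial⟩
  | cons b w ih =>
    obtain ⟨t, ht⟩ := ih
    exact ⟨node t t, by cases b <;> exact ht⟩

theorem exists_isLeaf_of_disjoint {p q : List Bool} (h : Disjoint (cone p) (cone q)) :
    ∃ t : BTree, t.IsLeaf p ∧ t.IsLeaf q := by
  rw [disjoint_cone_iff] at h
  induction p generalizing q with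
  | nil => exact (h.1 List.nil_prefix).elim
  | cons a p ih =>
    cases q with
    | nil => exact (h.2 List.nil_prefix).elim
    | cons b q =>
      by_cases hab : a = b
      · subst hab
        obtain ⟨t, hp, hq⟩ := ih (q := q) (by simpa using h)
        exact ⟨node t t, by cases a <;> exact hp, by cases a <;> exact hq⟩
      · obtain ⟨t, hp⟩ := exists_isLeaf p
        obtain ⟨s, hq⟩ := exists_isLeaf q
        cases a <;> cases b
        · exact (hab rfl).elim
        · exact ⟨node t s, hp, hq⟩
        · exact ⟨node s t, hp, hq⟩
        · exact (hab rfl).elim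

theorem disjoint_cone_of_ne {t : BTree} {l l' : t.Leaf} (h : l ≠ l') :
    Disjoint (cone l.1) (cone l'.1) := by
  refine disjoint_cone_iff.2 ⟨?_, ?_⟩ <;> rintro ⟨m, hm⟩
  · exact h (Subtype.ext (isLeaf_unique t l.2 l'.2 (n := []) (by simpa using hm)).1)
  · exact h (Subtype.ext (isLeaf_unique t l'.2 l.2 (n := []) (by simpa using hm)).1.symm)

end BTree

section Action

/-- `v` replaces the prefix `p` by `q` on the cone of `p`. -/
def MapsCone (v : ThompsonV) (p q : List Bool) : Prop := ∀ x, v • cat p x = cat q x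

namespace MapsCone

variable {v : ThompsonV} {p q : List Bool}

theorem append (h : MapsCone v p q) (m : List Bool) : MapsCone v (p ++ m) (q ++ m) := fun x => by
  rw [cat_append, cat_append, h]

theorem inv (h : MapsCone v p q) : MapsCone v⁻¹ q p := fun x => by
  rw [inv_smul_eq_iff, h]

theorem smul_cone (h : MapsCone v p q) : v • cone p = cone q := by
  rw [cone, cone, ← Set.image_smul, ← Set.range_comp]
  exact congrArg Set.range (funext h)

theorem mul {w : ThompsonV} {r : List Bool} (hw : MapsCone w q r) (hv : MapsCone v p q) :
    MapsCone (w * v) p r := fun x => by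
  rw [mul_smul, hv, hw]

theorem of_halves (hv : ∀ b, MapsCone v (p ++ [b]) (q ++ [b])) : MapsCone v p q := fun x => by
  obtain ⟨w, y, hw, rfl⟩ := exists_cat_eq 1 x
  obtain ⟨b, rfl⟩ := List.length_eq_one_iff.1 hw
  rw [← cat_append, ← cat_append, hv]

end MapsCone

theorem mapsCone_of_carries {v : ThompsonV} {t s : BTree} {b : t.Leaf ≃ s.Leaf}
    (h : Carries v.1 t s b) (l : t.Leaf) : MapsCone v l.1 (b l).1 := h l

theorem eventually_exists_mapsCone (v : ThompsonV) (n : ℕ) :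
    ∀ᶠ w in longWords, ∃ w', n ≤ w'.length ∧ MapsCone v w w' := by
  obtain ⟨t, s, b, h⟩ := v.2
  obtain ⟨r, hr⟩ := exists_leaf_length_ge n
  obtain ⟨s', hs, hrs⟩ := exists_ge_ge s r
  obtain ⟨t', -, c, hc, -⟩ := h.symm.refine hs
  have hv : Carries v.1 t' s' c.symm := by simpa using hc.symm
  filter_upwards [eventually_exists_leaf_isPrefix t'] with w ⟨l, m, hw⟩
  obtain ⟨p, u, hp⟩ := exists_prefix hrs (c.symm l)
  refine ⟨(c.symm l).1 ++ m, ?_, hw ▸ (mapsCone_of_carries hv l).append m⟩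
  have := hr p.1 p.2
  simp only [hp, List.length_append]
  omega

theorem exists_disjoint_smul_cone {v : ThompsonV} (hv : v ≠ 1) :
    ∃ e, Disjoint (v • cone e) (cone e) := by
  obtain ⟨x, hx⟩ : ∃ x : Cantor, v • x ≠ x := by
    by_contra! h
    exact hv (Subtype.ext (Equiv.ext h))
  obtain ⟨i, hi⟩ := Function.ne_iff.1 hx
  obtain ⟨n, hn⟩ := eventually_longWords.1 (eventually_exists_mapsCone v (i + 1))
  obtain ⟨w, y, hw, rfl⟩ := exists_cat_eq (max n (i + 1)) x
  obtain ⟨w', hw', h⟩ := hn w (by omega)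
  refine ⟨w, ?_⟩
  rw [h.smul_cone, disjoint_cone_iff]
  rw [h, cat_apply_of_lt (by omega), cat_apply_of_lt (by omega)] at hi
  exact ⟨fun hp => hi (hp.getElem _), fun hp => hi (hp.getElem _).symm⟩

end Action

section ConeSwap

/-- The embedding of two copies of the Cantor space onto two disjoint cones. -/
def conePair (p q : List Bool) (h : Disjoint (cone p) (cone q)) : Cantor ⊕ Cantor ↪ Cantor :=
  ⟨Sum.elim (cat p) (cat q), (cat_injective p).sumElim (cat_injective q)
    fun x y => h.ne_of_mem (cat_mem_cone p x) (cat_mem_cone q y)⟩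

theorem notMem_range_conePair {p q : List Bool} {h : Disjoint (cone p) (cone q)} {x : Cantor}
    (hp : x ∉ cone p) (hq : x ∉ cone q) : x ∉ Set.range (conePair p q h) := by
  rintro ⟨y | y, rfl⟩
  · exact hp (cat_mem_cone p y)
  · exact hq (cat_mem_cone q y)

/-- The element of Thompson's group that exchanges the prefixes `p` and `q` and fixes every sequence
without such a prefix. -/
def coneSwap (p q : List Bool) (h : Disjoint (cone p) (cone q)) : ThompsonV :=
  ⟨Equiv.Perm.viaEmbedding (Equiv.sumComm Cantor Cantor) (conePair p q h), by
    classical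
    obtain ⟨t, hp, hq⟩ := exists_isLeaf_of_disjoint h
    let l : t.Leaf := ⟨p, hp⟩
    let l' : t.Leaf := ⟨q, hq⟩
    refine ⟨t, t, Equiv.swap l l', fun r x => ?_⟩
    rcases eq_or_ne r l with rfl | hr
    · rw [Equiv.swap_apply_left]
      exact Equiv.Perm.viaEmbedding_apply _ (conePair p q h) (.inl x)
    rcases eq_or_ne r l' with rfl | hr'
    · rw [Equiv.swap_apply_right]
      exact Equiv.Perm.viaEmbedding_apply _ (conePair p q h) (.inr x)
    · rw [Equiv.swap_apply_of_ne_of_ne hr hr']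
      exact Equiv.Perm.viaEmbedding_apply_of_notMem _ _ _ (notMem_range_conePair
        (Set.disjoint_left.1 (disjoint_cone_of_ne hr) (cat_mem_cone _ x))
        (Set.disjoint_left.1 (disjoint_cone_of_ne hr') (cat_mem_cone _ x)))⟩

variable {p q : List Bool} (h : Disjoint (cone p) (cone q))

theorem mapsCone_coneSwap_left : MapsCone (coneSwap p q h) p q := fun x =>
  Equiv.Perm.viaEmbedding_apply _ (conePair p q h) (.inl x)

theorem mapsCone_coneSwap_right : MapsCone (coneSwap p q h) q p := fun x =>
  Equiv.Perm.viaEmbedding_apply _ (conePair p q h) (.inr x)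

theorem coneSwap_smul_of_notMem {x : Cantor} (hp : x ∉ cone p) (hq : x ∉ cone q) :
    coneSwap p q h • x = x :=
  Equiv.Perm.viaEmbedding_apply_of_notMem _ _ _ (notMem_range_conePair hp hq)

theorem mapsCone_coneSwap_of_disjoint {r : List Bool} (hp : Disjoint (cone r) (cone p))
    (hq : Disjoint (cone r) (cone q)) : MapsCone (coneSwap p q h) r r := fun x =>
  coneSwap_smul_of_notMem h (Set.disjoint_left.1 hp (cat_mem_cone r x))
    (Set.disjoint_left.1 hq (cat_mem_cone r x))

variable {h} in
theorem eq_coneSwap {v : ThompsonV} (hpq : MapsCone v p q) (hqp : MapsCone v q p)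
    (hv : ∀ x, x ∉ cone p → x ∉ cone q → v • x = x) : v = coneSwap p q h := by
  refine eq_of_smul_eq_smul fun x : Cantor => ?_
  by_cases hp : x ∈ cone p
  · obtain ⟨x, rfl⟩ := hp
    rw [hpq, mapsCone_coneSwap_left]
  by_cases hq : x ∈ cone q
  · obtain ⟨x, rfl⟩ := hq
    rw [hqp, mapsCone_coneSwap_right]
  · rw [hv x hp hq, coneSwap_smul_of_notMem h hp hq]

theorem inv_coneSwap : (coneSwap p q h)⁻¹ = coneSwap p q h :=
  eq_coneSwap (mapsCone_coneSwap_right h).inv (mapsCone_coneSwap_left h).inv fun x hp hq => by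
    rw [inv_smul_eq_iff, coneSwap_smul_of_notMem h hp hq]

theorem conj_coneSwap {v : ThompsonV} {p' q' : List Bool} {h' : Disjoint (cone p') (cone q')}
    (hp : MapsCone v p p') (hq : MapsCone v q q') :
    v * coneSwap p q h * v⁻¹ = coneSwap p' q' h' := by
  refine eq_coneSwap (fun x => ?_) (fun x => ?_) fun x hp' hq' => ?_
  · rw [mul_smul, mul_smul, hp.inv, mapsCone_coneSwap_left, hq]
  · rw [mul_smul, mul_smul, hq.inv, mapsCone_coneSwap_right, hp]
  · rw [← hp.smul_cone, Set.mem_smul_set_iff_inv_smul_mem] at hp'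
    rw [← hq.smul_cone, Set.mem_smul_set_iff_inv_smul_mem] at hq'
    rw [mul_smul, mul_smul, coneSwap_smul_of_notMem h hp' hq', smul_inv_smul]

theorem coneSwap_eq_mul :
    coneSwap p q h = coneSwap (p ++ [false]) (q ++ [false]) (disjoint_cone_append h _ _) *
      coneSwap (p ++ [true]) (q ++ [true]) (disjoint_cone_append h _ _) := by
  symm
  have hp := disjoint_cone_append_left_iff (p := p).2 disjoint_cone_false_true
  have hq := disjoint_cone_append_left_iff (p := q).2 disjoint_cone_false_true
  refine eq_coneSwap (.of_halves fun b => ?_) (.of_halves fun b => ?_)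
    fun x hxp hxq => ?_
  · cases b
    · exact (mapsCone_coneSwap_left _).mul
        (mapsCone_coneSwap_of_disjoint _ hp (disjoint_cone_append h _ _))
    · exact (mapsCone_coneSwap_of_disjoint _ (disjoint_cone_append h.symm _ _) hq.symm).mul
        (mapsCone_coneSwap_left _)
  · cases b
    · exact (mapsCone_coneSwap_right _).mul
        (mapsCone_coneSwap_of_disjoint _ (disjoint_cone_append h.symm _ _) hq)
    · exact (mapsCone_coneSwap_of_disjoint _ hp.symm (disjoint_cone_append h _ _)).mul
        (mapsCone_coneSwap_right _)
  · rw [cone_eq_union, Set.mem_union, not_or] at hxp hxq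
    rw [mul_smul, coneSwap_smul_of_notMem _ hxp.2 hxq.2, coneSwap_smul_of_notMem _ hxp.1 hxq.1]

end ConeSwap

section SwapGroup

/-- The subgroup of Thompson's group generated by the swaps of two disjoint cones inside the cone of
`e`. -/
def swapGroup (e : List Bool) : Subgroup ThompsonV :=
  Subgroup.closure {v | ∃ p q h, v = coneSwap (e ++ p) (e ++ q) h}

theorem coneSwap_mem_swapGroup {e p q : List Bool} (h : Disjoint (cone (e ++ p)) (cone (e ++ q))) :
    coneSwap (e ++ p) (e ++ q) h ∈ swapGroup e :=
  Subgroup.subset_closure ⟨p, q, h, rfl⟩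

theorem swapGroup_le_iff {e : List Bool} {N : Subgroup ThompsonV} :
    swapGroup e ≤ N ↔ ∀ p q h, coneSwap (e ++ p) (e ++ q) h ∈ N := by
  refine ⟨fun hN p q h => hN (coneSwap_mem_swapGroup h), fun hN => (Subgroup.closure_le N).2 ?_⟩
  rintro _ ⟨p, q, h, rfl⟩
  exact hN p q h

theorem swapGroup_append_le (e r : List Bool) : swapGroup (e ++ r) ≤ swapGroup e :=
  swapGroup_le_iff.2 fun p q h => by
    simp only [List.append_assoc] at h ⊢
    exact coneSwap_mem_swapGroup h

theorem swapGroup_le_of_mapsCone {A : Subgroup ThompsonV} {v : ThompsonV} {c d : List Bool}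
    (hv : v ∈ Subgroup.normalizer A) (hcd : MapsCone v c d) (hc : swapGroup c ≤ A) :
    swapGroup d ≤ A :=
  swapGroup_le_iff.2 fun p q h => by
    have h' : Disjoint (cone (c ++ p)) (cone (c ++ q)) :=
      disjoint_cone_append_left_iff.2 (disjoint_cone_append_left_iff.1 h)
    rw [← conj_coneSwap h' (hcd.append p) (hcd.append q)]
    exact (Subgroup.mem_normalizer_iff.1 hv _).1 (hc (coneSwap_mem_swapGroup h'))

theorem exists_not_commute_mem_swapGroup (e : List Bool) :
    ∃ x ∈ swapGroup e, ∃ y ∈ swapGroup e, ¬ Commute x y := by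
  have h₁ : Disjoint (cone (e ++ [false, false])) (cone (e ++ [false, true])) := by
    simp [disjoint_cone_iff]
  have h₂ : Disjoint (cone (e ++ [false, false])) (cone (e ++ [true])) := by
    simp [disjoint_cone_iff]
  have h₃ : Disjoint (cone (e ++ [false, true])) (cone (e ++ [true])) := by
    simp [disjoint_cone_iff]
  refine ⟨_, coneSwap_mem_swapGroup h₁, _, coneSwap_mem_swapGroup h₂, fun hxy => ?_⟩
  have hl := (mapsCone_coneSwap_of_disjoint h₁ h₂.symm h₃.symm).mul (mapsCone_coneSwap_left h₂)
  have hr := (mapsCone_coneSwap_of_disjoint h₂ h₁.symm h₃).mul (mapsCone_coneSwap_left h₁)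
  have he : e ++ [true] = e ++ [false, true] := cat_left_injective fun x => by
    rw [← hl x, hxy.eq, hr x]
  simp at he

theorem swapGroup_le_commutator (e : List Bool) : swapGroup e ≤ ⁅swapGroup e, swapGroup e⁆ :=
  swapGroup_le_iff.2 fun p q h => by
    have hp : Disjoint (cone (e ++ (p ++ [false]))) (cone (e ++ (p ++ [true]))) := by
      simp [disjoint_cone_iff]
    have hq : Disjoint (cone (e ++ (q ++ [false]))) (cone (e ++ (q ++ [true]))) := by
      simp [disjoint_cone_iff]
    have h' (u w : List Bool) : Disjoint (cone (e ++ (p ++ u))) (cone (e ++ (q ++ w))) := by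
      simpa using disjoint_cone_append h u w
    set f := coneSwap (e ++ (p ++ [false])) (e ++ (q ++ [false])) (h' _ _)
    set g := coneSwap _ _ hp * coneSwap _ _ hq
    have hgp : MapsCone g (e ++ (p ++ [false])) (e ++ (p ++ [true])) :=
      (mapsCone_coneSwap_left hp).mul (mapsCone_coneSwap_of_disjoint hq (h' _ _) (h' _ _))
    have hgq : MapsCone g (e ++ (q ++ [false])) (e ++ (q ++ [true])) :=
      (mapsCone_coneSwap_of_disjoint hp (h' _ _).symm (h' _ _).symm).mul (mapsCone_coneSwap_left hq)
    have hswap : coneSwap (e ++ p) (e ++ q) h = ⁅f, g⁆ := by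
      rw [commutatorElement_def, mul_assoc, mul_assoc, ← mul_assoc g, inv_coneSwap,
        conj_coneSwap (h' _ _) (h' := h' [true] [true]) hgp hgq, coneSwap_eq_mul]
      simp only [f, List.append_assoc]
    rw [hswap]
    exact Subgroup.commutator_mem_commutator (coneSwap_mem_swapGroup _)
      (mul_mem (coneSwap_mem_swapGroup _) (coneSwap_mem_swapGroup _))

theorem swapGroup_le_fixingSubgroup (e : List Bool) :
    swapGroup e ≤ fixingSubgroup ThompsonV (cone e)ᶜ :=
  swapGroup_le_iff.2 fun p q h => (mem_fixingSubgroup_iff _).2 fun _ hx =>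
    coneSwap_smul_of_notMem h (fun hp => hx (cone_anti (e.prefix_append p) hp))
      (fun hq => hx (cone_anti (e.prefix_append q) hq))

theorem commute_of_mem_fixingSubgroup {f g : ThompsonV} {S T : Set Cantor}
    (hf : f ∈ fixingSubgroup ThompsonV S) (hg : g ∈ fixingSubgroup ThompsonV T)
    (hST : S ∪ T = Set.univ) : Commute f g := by
  rw [mem_fixingSubgroup_iff] at hf hg
  have hfg : f.1.Disjoint g.1 := fun x => (hST ▸ Set.mem_univ x).imp (hf x) (hg x)
  exact Subtype.ext hfg.commute.eq

theorem commutator_le_of_conj_commute {G : Type*} [Group G] {N H : Subgroup G} {a : G} (ha : a ∈ N)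
    (hH : H ≤ Subgroup.normalizer N) (h : ∀ f ∈ H, ∀ g ∈ H, Commute (a * f * a⁻¹) g) :
    ⁅H, H⁆ ≤ N := by
  rw [Subgroup.commutator_le]
  intro f hf g hg
  have hn : f * (a * f * a⁻¹)⁻¹ ∈ N := by
    simpa [mul_assoc] using
      mul_mem ((Subgroup.mem_normalizer_iff.1 (hH hf) a).1 ha) (inv_mem ha)
  have hcg := (h f hf g hg).eq
  generalize a * f * a⁻¹ = c at hn hcg
  have hfg : ⁅f, g⁆ = f * c⁻¹ * (g * (f * c⁻¹)⁻¹ * g⁻¹) :=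
    calc f * g * f⁻¹ * g⁻¹ = f * c⁻¹ * (c * g) * f⁻¹ * g⁻¹ := by group
      _ = f * c⁻¹ * (g * (f * c⁻¹)⁻¹ * g⁻¹) := by rw [hcg]; group
  rw [hfg]
  exact mul_mem hn ((Subgroup.mem_normalizer_iff.1 (hH hg) _).1 (inv_mem hn))

theorem swapGroup_le_of_disjoint_smul {N : Subgroup ThompsonV} {a : ThompsonV} {e : List Bool}
    (ha : a ∈ N) (he : Disjoint (a • cone e) (cone e))
    (hN : swapGroup e ≤ Subgroup.normalizer N) : swapGroup e ≤ N := by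
  refine (swapGroup_le_commutator e).trans (commutator_le_of_conj_commute ha hN fun f hf g hg => ?_)
  refine commute_of_mem_fixingSubgroup (S := (a • cone e)ᶜ) ?_ (swapGroup_le_fixingSubgroup e hg) ?_
  · exact Set.conj_mem_fixingSubgroup Set.smul_set_compl (swapGroup_le_fixingSubgroup e hf)
  · rw [← Set.compl_inter, he.inter_eq, Set.compl_empty]

theorem exists_not_commute_of_swapGroup_le {A B : Subgroup ThompsonV} {c d : List Bool}
    (hc : swapGroup c ≤ A) (hd : swapGroup d ≤ B)
    (h : Disjoint (cone c) (cone d) → ∃ v ∈ Subgroup.normalizer A, ∃ r, MapsCone v (c ++ r) d) :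
    ∃ x ∈ A, ∃ y ∈ B, ¬ Commute x y := by
  suffices ∃ e, swapGroup e ≤ A ∧ swapGroup e ≤ B by
    obtain ⟨e, hA, hB⟩ := this
    obtain ⟨x, hx, y, hy, hxy⟩ := exists_not_commute_mem_swapGroup e
    exact ⟨x, hA hx, y, hB hy, hxy⟩
  by_cases hcd : c <+: d
  · obtain ⟨r, rfl⟩ := hcd
    exact ⟨_, (swapGroup_append_le c r).trans hc, hd⟩
  by_cases hdc : d <+: c
  · obtain ⟨r, rfl⟩ := hdc
    exact ⟨_, hc, (swapGroup_append_le d r).trans hd⟩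
  · obtain ⟨v, hv, r, hr⟩ := h (disjoint_cone_iff.2 ⟨hcd, hdc⟩)
    exact ⟨d, swapGroup_le_of_mapsCone hv hr ((swapGroup_append_le c r).trans hc), hd⟩

end SwapGroup

section Restrict

variable {Γ : Type*} [Group Γ] (α₀ α₁ : Γ →* Γ) {t : BTree}

open Classical in
/-- The function on words that a family `g` on the leaves of `t` propagates to: its value at
`ℓ · m`, for a leaf `ℓ`, is `α_m (g ℓ)`, and at a word above the leaves it is the junk value `1`. -/
def value (g : t.Leaf → Γ) (w : List Bool) : Γ :=
  if h : ∃ l : t.Leaf, l.1 <+: w then wordEnd α₀ α₁ (w.drop h.choose.1.length) (g h.choose) else 1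

theorem value_append (g : t.Leaf → Γ) (l : t.Leaf) (m : List Bool) :
    value α₀ α₁ g (l.1 ++ m) = wordEnd α₀ α₁ m (g l) := by
  have h : ∃ l' : t.Leaf, l'.1 <+: l.1 ++ m := ⟨l, l.1.prefix_append m⟩
  obtain ⟨u, hu⟩ := h.choose_spec
  obtain ⟨hl, rfl⟩ := isLeaf_unique t h.choose.2 l.2 hu
  rw [value, dif_pos h, hl, List.drop_left, Subtype.ext hl]

theorem value_mul (g g' : t.Leaf → Γ) :
    value α₀ α₁ (g * g') = value α₀ α₁ g * value α₀ α₁ g' := by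
  funext w
  rw [Pi.mul_apply, value, value, value]
  split_ifs
  · exact map_mul _ _ _
  · exact (mul_one 1).symm

theorem transition_eq_value {s : BTree} (h : t ≤ s) (g : t.Leaf → Γ) (q : s.Leaf) :
    transition α₀ α₁ t s h g q = value α₀ α₁ g q.1 := by
  rw [parent_append_path h q, value_append,
    transition_apply α₀ α₁ h g q _ _ (parent_append_path h q)]

theorem eventually_value_transition {s : BTree} (h : t ≤ s) (g : t.Leaf → Γ) :
    ∀ᶠ w in longWords, value α₀ α₁ (transition α₀ α₁ t s h g) w = value α₀ α₁ g w := by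
  filter_upwards [eventually_exists_leaf_isPrefix s] with w ⟨l, m, hw⟩
  rw [← hw, value_append, transition_eq_value, parent_append_path h l, List.append_assoc,
    value_append, value_append, wordEnd_append]

/-- The restriction of an element of the limit group to the cone of `w`: the germ at infinity of the
function on words that it propagates to below `w`. -/
def restrict (w : List Bool) : LimitGroup α₀ α₁ →* Germ longWords Γ :=
  MonoidHom.mk' (DirectLimit.lift (transition α₀ α₁)
    (fun _ g => ((fun m => value α₀ α₁ g (w ++ m) : List Bool → Γ) : Germ longWords Γ))
    fun _ _ h g => Germ.coe_eq.2 <| (tendsto_append_longWords w).eventually <|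
      (eventually_value_transition α₀ α₁ h g).mono fun _ => Eq.symm) fun k k' => by
  obtain ⟨t, g, g', rfl, rfl⟩ := DirectLimit.exists_eq_mk₂ (transition α₀ α₁) k k'
  rw [DirectLimit.mul_def, DirectLimit.lift_def, value_mul]
  rfl

theorem exists_eq_cls (k : LimitGroup α₀ α₁) :
    ∃ (t : BTree) (g : t.Leaf → Γ), k = cls α₀ α₁ g :=
  DirectLimit.exists_eq_mk (transition α₀ α₁) k

variable {α₀ α₁}

theorem restrict_cls_eq_iff {s : BTree} {w w' : List Bool} {g : t.Leaf → Γ}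
    {g' : s.Leaf → Γ} :
    restrict α₀ α₁ w (cls α₀ α₁ g) = restrict α₀ α₁ w' (cls α₀ α₁ g') ↔
      ∀ᶠ m in longWords, value α₀ α₁ g (w ++ m) = value α₀ α₁ g' (w' ++ m) :=
  Germ.coe_eq

theorem restrict_cls_eq_one_iff {w : List Bool} {g : t.Leaf → Γ} :
    restrict α₀ α₁ w (cls α₀ α₁ g) = 1 ↔ ∀ᶠ m in longWords, value α₀ α₁ g (w ++ m) = 1 :=
  Germ.coe_eq

theorem restrict_append_congr {w w' : List Bool} {k k' : LimitGroup α₀ α₁}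
    (h : restrict α₀ α₁ w k = restrict α₀ α₁ w' k') (m : List Bool) :
    restrict α₀ α₁ (w ++ m) k = restrict α₀ α₁ (w' ++ m) k' := by
  obtain ⟨t, g, rfl⟩ := exists_eq_cls α₀ α₁ k
  obtain ⟨s, g', rfl⟩ := exists_eq_cls α₀ α₁ k'
  rw [restrict_cls_eq_iff] at h ⊢
  simpa only [List.append_assoc] using (tendsto_append_longWords m).eventually h

theorem restrict_append_eq_one {w : List Bool} {k : LimitGroup α₀ α₁}
    (h : restrict α₀ α₁ w k = 1) (m : List Bool) : restrict α₀ α₁ (w ++ m) k = 1 := by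
  rw [restrict_append_congr (h.trans (map_one (restrict α₀ α₁ w)).symm), map_one]

theorem restrict_nil_injective : Function.Injective (restrict α₀ α₁ []) := by
  intro k k' h
  obtain ⟨t, g, rfl⟩ := exists_eq_cls α₀ α₁ k
  obtain ⟨s, g', rfl⟩ := exists_eq_cls α₀ α₁ k'
  obtain ⟨n, hn⟩ := eventually_longWords.1 (restrict_cls_eq_iff.1 h)
  obtain ⟨r, hr⟩ := exists_leaf_length_ge n
  obtain ⟨u, htu, hsu⟩ := exists_ge_ge t s
  obtain ⟨u', huu', hru'⟩ := exists_ge_ge u r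
  refine (cls_eq α₀ α₁).2 ⟨u', htu.trans huu', hsu.trans huu', funext fun q => ?_⟩
  have hq : n ≤ q.1.length := by
    rw [parent_append_path hru' q, List.length_append]
    exact (hr _ (parent hru' q).2).trans (Nat.le_add_right _ _)
  rw [transition_eq_value, transition_eq_value]
  exact hn q.1 hq

theorem restrict_eq_iff_cons {w : List Bool} {k k' : LimitGroup α₀ α₁} :
    restrict α₀ α₁ w k = restrict α₀ α₁ w k' ↔
      ∀ b, restrict α₀ α₁ (w ++ [b]) k = restrict α₀ α₁ (w ++ [b]) k' := by
  refine ⟨fun h b => restrict_append_congr h [b], fun h => ?_⟩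
  obtain ⟨t, g, rfl⟩ := exists_eq_cls α₀ α₁ k
  obtain ⟨s, g', rfl⟩ := exists_eq_cls α₀ α₁ k'
  rw [restrict_cls_eq_iff, eventually_longWords_iff_cons]
  intro b
  simpa using restrict_cls_eq_iff.1 (h b)

theorem eq_of_eventually_restrict_eq {k k' : LimitGroup α₀ α₁}
    (h : ∀ᶠ w in longWords, restrict α₀ α₁ w k = restrict α₀ α₁ w k') : k = k' := by
  obtain ⟨n, hn⟩ := eventually_longWords.1 h
  suffices ∀ j w, n ≤ w.length + j → restrict α₀ α₁ w k = restrict α₀ α₁ w k' from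
    restrict_nil_injective (this n [] (by simp))
  intro j
  induction j with
  | zero => exact hn
  | succ j ih => exact fun w hw => restrict_eq_iff_cons.2 fun b => ih _ (by simp; omega)

theorem restrict_jonesAction {v : ThompsonV} {w w' : List Bool} (hv : MapsCone v w w')
    (k : LimitGroup α₀ α₁) :
    restrict α₀ α₁ w' (jonesAction α₀ α₁ v k) = restrict α₀ α₁ w k := by
  obtain ⟨t, s, b, g, -, h, rfl, -⟩ := exists_rep α₀ α₁ v k k
  have hcls : jonesAction α₀ α₁ v (cls α₀ α₁ g) = cls α₀ α₁ (g ∘ b.symm) :=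
    jonesFun_cls α₀ α₁ v h g
  rw [hcls, restrict_cls_eq_iff]
  filter_upwards [(tendsto_append_longWords w).eventually (eventually_exists_leaf_isPrefix t)]
    with m ⟨l, u, hu⟩
  have hw' : w' ++ m = (b l).1 ++ u := cat_left_injective fun x => by
    rw [← hv.append m x, ← hu, (mapsCone_of_carries h l).append u x]
  rw [hw', ← hu, value_append, value_append, Function.comp_apply, Equiv.symm_apply_apply]

end Restrict

section Values

variable {Γ : Type*} [Group Γ] {α₀ α₁ : Γ →* Γ}

variable (α₀ α₁) in
/-- The element of the limit group represented by `γ` at the only leaf of the trivial tree. -/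
def rootCls : Γ →* LimitGroup α₀ α₁ :=
  MonoidHom.mk' (fun γ => cls α₀ α₁ (t := leaf) fun _ => γ) fun _ _ => cls_mul α₀ α₁ _ _

theorem value_root (γ : Γ) (w : List Bool) :
    value α₀ α₁ (t := leaf) (fun _ => γ) w = wordEnd α₀ α₁ w γ :=
  value_append α₀ α₁ (t := leaf) (fun _ => γ) ⟨[], trivial⟩ w

theorem eventually_exists_restrict_eq_rootCls (k : LimitGroup α₀ α₁) :
    ∀ᶠ w in longWords, ∃ γ, restrict α₀ α₁ w k = restrict α₀ α₁ [] (rootCls α₀ α₁ γ) := by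
  obtain ⟨t, g, rfl⟩ := exists_eq_cls α₀ α₁ k
  filter_upwards [eventually_exists_leaf_isPrefix t] with w ⟨l, m, hw⟩
  refine ⟨wordEnd α₀ α₁ m (g l), restrict_cls_eq_iff.2 (.of_forall fun u => ?_)⟩
  rw [← hw, List.append_assoc, value_append, wordEnd_append, List.nil_append, value_root]

theorem restrict_rootCls_eq_one {m : List Bool} (hm : wordEnd α₀ α₁ m = 1) (γ : Γ) :
    restrict α₀ α₁ m (rootCls α₀ α₁ γ) = 1 :=
  restrict_cls_eq_one_iff.2 <| .of_forall fun u => by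
    rw [value_root, wordEnd_append, hm, MonoidHom.one_apply, map_one]

theorem wordEnd_injective (h₀ : Function.Injective α₀) (h₁ : Function.Injective α₁)
    (w : List Bool) : Function.Injective (wordEnd α₀ α₁ w) := by
  induction w with
  | nil => exact Function.injective_id
  | cons b _ ih => cases b; exacts [ih.comp h₀, ih.comp h₁]

theorem restrict_rootCls_injective (h₀ : Function.Injective α₀) (h₁ : Function.Injective α₁)
    (w : List Bool) : Function.Injective ((restrict α₀ α₁ w).comp (rootCls α₀ α₁)) := by
  intro γ γ' h
  have hval : ∀ᶠ m in longWords, value α₀ α₁ (t := leaf) (fun _ => γ) (w ++ m) =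
      value α₀ α₁ (t := leaf) (fun _ => γ') (w ++ m) := restrict_cls_eq_iff.1 h
  obtain ⟨m, hm⟩ := hval.exists
  rw [value_root, value_root] at hm
  exact wordEnd_injective h₀ h₁ _ hm

theorem eventually_restrict_append_eq_one {m : List Bool} (hm : wordEnd α₀ α₁ m = 1)
    (k : LimitGroup α₀ α₁) : ∀ᶠ w in longWords, restrict α₀ α₁ (w ++ m) k = 1 := by
  filter_upwards [eventually_exists_restrict_eq_rootCls k] with w ⟨γ, hγ⟩
  rw [restrict_append_congr hγ, List.nil_append, restrict_rootCls_eq_one hm]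

theorem exists_restrict_append_eq_one {m : List Bool} (hm : wordEnd α₀ α₁ m = 1)
    (k : LimitGroup α₀ α₁) (c : List Bool) : ∃ e, restrict α₀ α₁ (c ++ e) k = 1 := by
  obtain ⟨e, he⟩ :=
    ((tendsto_append_longWords c).eventually (eventually_restrict_append_eq_one hm k)).exists
  exact ⟨e ++ m, by rwa [← List.append_assoc]⟩

theorem exists_restrict_eq_of_append (h₀ : Function.Injective α₀) (h₁ : Function.Injective α₁)
    (k : LimitGroup α₀ α₁) : ∃ n, ∀ w w' m : List Bool, n ≤ w.length → n ≤ w'.length →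
      restrict α₀ α₁ (w ++ m) k = restrict α₀ α₁ (w' ++ m) k →
        restrict α₀ α₁ w k = restrict α₀ α₁ w' k := by
  obtain ⟨n, hn⟩ := eventually_longWords.1 (eventually_exists_restrict_eq_rootCls k)
  refine ⟨n, fun w w' m hw hw' h => ?_⟩
  obtain ⟨γ, hγ⟩ := hn w hw
  obtain ⟨γ', hγ'⟩ := hn w' hw'
  rw [restrict_append_congr hγ, restrict_append_congr hγ'] at h
  obtain rfl : γ = γ' := restrict_rootCls_injective h₀ h₁ _ h
  exact hγ.trans hγ'.symm

theorem exists_restrict_eq_and_eq_one (k : LimitGroup α₀ α₁) (b : Bool) :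
    ∃ x, restrict α₀ α₁ [b] x = restrict α₀ α₁ [b] k ∧ restrict α₀ α₁ [!b] x = 1 := by
  obtain ⟨t, g, rfl⟩ := exists_eq_cls α₀ α₁ k
  obtain ⟨s, hts, f, rfl⟩ := exists_ge_ge t (node leaf leaf)
  rw [← cls_transition α₀ α₁ hts]
  set g' := transition α₀ α₁ _ _ hts g
  let x : ((node leaf leaf).graft f).Leaf → Γ := fun l => if l.1.head? = some b then g' l else 1
  have hx : ∀ c, ∀ᶠ w in longWords,
      value α₀ α₁ x (c :: w) = if c = b then value α₀ α₁ g' (c :: w) else 1 := fun c => by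
    filter_upwards [(tendsto_append_longWords [c]).eventually
      (eventually_exists_leaf_isPrefix ((node leaf leaf).graft f))] with w ⟨⟨l, hl⟩, m, hlm⟩
    cases l with
    | nil => exact hl.elim
    | cons d l =>
      obtain ⟨rfl, rfl⟩ : d = c ∧ l ++ m = w := by simpa using hlm
      have hv (y) : value α₀ α₁ y (d :: (l ++ m)) = wordEnd α₀ α₁ m (y ⟨d :: l, hl⟩) :=
        value_append α₀ α₁ y ⟨d :: l, hl⟩ m
      rw [hv, hv]
      by_cases hd : d = b <;> simp [x, hd]
  refine ⟨cls α₀ α₁ x, restrict_cls_eq_iff.2 ?_, restrict_cls_eq_one_iff.2 ?_⟩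
  · simpa using hx b
  · simpa using hx (!b)

theorem nontrivial_of_nontrivial_limitGroup (h : Nontrivial (LimitGroup α₀ α₁)) : Nontrivial Γ := by
  by_contra hΓ
  rw [not_nontrivial_iff_subsingleton] at hΓ
  refine not_subsingleton (LimitGroup α₀ α₁) ⟨fun k k' => ?_⟩
  obtain ⟨t, g, g', rfl, rfl⟩ := DirectLimit.exists_eq_mk₂ (transition α₀ α₁) k k'
  rw [Subsingleton.elim g g']

theorem exists_restrict_eq_one_iff (h₀ : Function.Injective α₀) (h₁ : Function.Injective α₁)
    (h : Nontrivial (LimitGroup α₀ α₁)) :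
    ∃ x, ∀ w, restrict α₀ α₁ w x = 1 ↔ [true] <+: w := by
  have := nontrivial_of_nontrivial_limitGroup h
  obtain ⟨γ, hγ⟩ := exists_ne (1 : Γ)
  obtain ⟨x, hxf, hxt⟩ := exists_restrict_eq_and_eq_one (rootCls α₀ α₁ γ) false
  have hx (w) : restrict α₀ α₁ ([false] ++ w) x ≠ 1 := by
    rw [restrict_append_congr hxf]
    exact fun hw => hγ ((map_eq_one_iff _ (restrict_rootCls_injective h₀ h₁ _)).1 hw)
  refine ⟨x, fun w => ?_⟩
  rcases w with _ | ⟨_ | _, w⟩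
  · exact iff_of_false (fun hw => hx [] (restrict_append_eq_one hw [false])) (by simp)
  · exact iff_of_false (hx w) (by simp)
  · exact iff_of_true (restrict_append_eq_one hxt w) (by simp)

end Values

section Invariance

variable {Γ : Type*} [Group Γ] {α₀ α₁ : Γ →* Γ} {k : LimitGroup α₀ α₁}

/-- The stabilizer of an element of the limit group under the Jones action. -/
def jonesStabilizer (k : LimitGroup α₀ α₁) : Subgroup ThompsonV :=
  (MulAction.stabilizer (MulAut (LimitGroup α₀ α₁)) k).comap (jonesAction α₀ α₁)

theorem mem_jonesStabilizer_iff {v : ThompsonV} :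
    v ∈ jonesStabilizer k ↔ jonesAction α₀ α₁ v k = k := Iff.rfl

theorem jonesAction_eq_self_of_eventually {v : ThompsonV}
    (h : ∀ᶠ w in longWords, ∃ w', MapsCone v w w' ∧
      restrict α₀ α₁ w k = restrict α₀ α₁ w' k) : jonesAction α₀ α₁ v k = k := by
  have hinv : v⁻¹ ∈ jonesStabilizer k := eq_of_eventually_restrict_eq <|
    h.mono fun w ⟨w', hv, hk⟩ => (restrict_jonesAction hv.inv k).trans hk.symm
  exact inv_mem_iff.1 hinv

theorem jonesAction_coneSwap_eq_self_iff {p q : List Bool} (h : Disjoint (cone p) (cone q)) :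
    jonesAction α₀ α₁ (coneSwap p q h) k = k ↔ restrict α₀ α₁ p k = restrict α₀ α₁ q k := by
  refine ⟨fun hk => ?_, fun hk => jonesAction_eq_self_of_eventually ?_⟩
  · rw [← restrict_jonesAction (mapsCone_coneSwap_left h), hk]
  · filter_upwards [eventually_length_ge p.length, eventually_length_ge q.length] with w hp hq
    by_cases hpw : p <+: w
    · obtain ⟨m, rfl⟩ := hpw
      exact ⟨q ++ m, (mapsCone_coneSwap_left h).append m, restrict_append_congr hk m⟩
    by_cases hqw : q <+: w
    · obtain ⟨m, rfl⟩ := hqw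
      exact ⟨p ++ m, (mapsCone_coneSwap_right h).append m, restrict_append_congr hk.symm m⟩
    · refine ⟨w, mapsCone_coneSwap_of_disjoint h (disjoint_cone_iff.2 ⟨fun hw => ?_, hpw⟩)
        (disjoint_cone_iff.2 ⟨fun hw => ?_, hqw⟩), rfl⟩
      · exact hpw (hw.eq_of_length_le hp ▸ List.prefix_rfl)
      · exact hqw (hw.eq_of_length_le hq ▸ List.prefix_rfl)

theorem swapGroup_le_jonesStabilizer {c : List Bool} (hc : restrict α₀ α₁ c k = 1) :
    swapGroup c ≤ jonesStabilizer k :=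
  swapGroup_le_iff.2 fun p q h => (jonesAction_coneSwap_eq_self_iff h).2 <|
    (restrict_append_eq_one hc p).trans (restrict_append_eq_one hc q).symm

end Invariance

section Kernel

theorem exists_swapGroup_le_of_ne_one {M A : Subgroup ThompsonV} (hM : M.Normal) (hAM : A ≤ M)
    (hMA : M ≤ Subgroup.normalizer A) {a : ThompsonV} (ha : a ∈ A) (ha₁ : a ≠ 1) :
    ∃ e, swapGroup e ≤ A := by
  obtain ⟨e, he⟩ := exists_disjoint_smul_cone ha₁
  have heM : swapGroup e ≤ M := swapGroup_le_of_disjoint_smul (hAM ha) he <| by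
    rw [Subgroup.normalizer_eq_top]; exact le_top
  exact ⟨e, swapGroup_le_of_disjoint_smul ha he (heM.trans hMA)⟩

theorem eq_bot_or_eq_bot_of_commute {M A B : Subgroup ThompsonV} (hM : M.Normal)
    (hAM : A ≤ M) (hBM : B ≤ M) (hMA : M ≤ Subgroup.normalizer A)
    (hMB : M ≤ Subgroup.normalizer B) (hAB : ∀ x ∈ A, ∀ y ∈ B, Commute x y) :
    A = ⊥ ∨ B = ⊥ := by
  by_contra! h
  obtain ⟨a, ha, ha₁⟩ := A.bot_or_exists_ne_one.resolve_left h.1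
  obtain ⟨b, hb, hb₁⟩ := B.bot_or_exists_ne_one.resolve_left h.2
  obtain ⟨c, hc⟩ := exists_swapGroup_le_of_ne_one hM hAM hMA ha ha₁
  obtain ⟨d, hd⟩ := exists_swapGroup_le_of_ne_one hM hBM hMB hb hb₁
  obtain ⟨x, hx, y, hy, hxy⟩ := exists_not_commute_of_swapGroup_le hc hd fun hcd => by
    have hd₀ : Disjoint (cone (c ++ [false])) (cone d) := by
      simpa using disjoint_cone_append hcd [false] []
    have hd₁ : Disjoint (cone (c ++ [true])) (cone d) := by
      simpa using disjoint_cone_append hcd [true] []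
    have hc₀₁ : Disjoint (cone (c ++ [false])) (cone (c ++ [true])) :=
      disjoint_cone_append_left_iff.2 disjoint_cone_false_true
    have hv : coneSwap _ _ hd₀ ∈ M := by
      rw [← conj_coneSwap hc₀₁ (mapsCone_coneSwap_of_disjoint hd₁ hc₀₁ hd₀)
        (mapsCone_coneSwap_left hd₁)]
      exact hM.conj_mem _ (hAM (hc (coneSwap_mem_swapGroup hc₀₁))) _
    exact ⟨_, hMA hv, [false], mapsCone_coneSwap_left hd₀⟩
  exact hxy (hAB x hx y hy)

variable {Γ : Type*} [Group Γ] {α₀ α₁ : Γ →* Γ}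

theorem commute_of_restrict_eq_one {k k' : LimitGroup α₀ α₁}
    (hk : restrict α₀ α₁ [false] k = 1) (hk' : restrict α₀ α₁ [true] k' = 1) : Commute k k' :=
  restrict_nil_injective <| restrict_eq_iff_cons.2 fun b => by
    cases b <;> simp [hk, hk']

theorem exists_mul_of_restrict_eq_one (k : LimitGroup α₀ α₁) :
    ∃ x y, restrict α₀ α₁ [false] x = 1 ∧ restrict α₀ α₁ [true] y = 1 ∧ x * y = k := by
  obtain ⟨y, hyf, hyt⟩ := exists_restrict_eq_and_eq_one k false
  obtain ⟨x, hxt, hxf⟩ := exists_restrict_eq_and_eq_one k true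
  refine ⟨x, y, hxf, hyt, restrict_nil_injective <| restrict_eq_iff_cons.2 fun b => ?_⟩
  cases b <;> simp_all

variable {ψ : FractionGroup α₀ α₁ →* ThompsonV}

theorem map_inl_eq_one_of_restrict {b : Bool}
    (h : ∀ k, restrict α₀ α₁ [b] k = 1 → ψ (.inl k) = 1) (k : LimitGroup α₀ α₁)
    (hk : restrict α₀ α₁ [!b] k = 1) : ψ (.inl k) = 1 := by
  have hb : Disjoint (cone [!b]) (cone [b]) := by simp [disjoint_cone_iff]
  have hswap := h (jonesAction α₀ α₁ (coneSwap _ _ hb) k) <| by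
    rw [restrict_jonesAction (mapsCone_coneSwap_left hb), hk]
  rwa [SemidirectProduct.inl_aut, map_mul, map_mul, map_inv, map_inv, conj_eq_one_iff] at hswap

theorem map_inl_eq_one (hψ : Function.Surjective ψ) (k : LimitGroup α₀ α₁) : ψ (.inl k) = 1 := by
  let half (b : Bool) := (restrict α₀ α₁ [b]).ker.map (ψ.comp SemidirectProduct.inl)
  have hM : (ψ.comp SemidirectProduct.inl).range.Normal := by
    rw [MonoidHom.range_comp, SemidirectProduct.range_inl_eq_ker_rightHom]
    exact Subgroup.Normal.map inferInstance ψ hψ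
  have hle (b) : half b ≤ (ψ.comp SemidirectProduct.inl).range := Subgroup.map_le_range _ _
  have hnorm (b) : (ψ.comp SemidirectProduct.inl).range ≤ Subgroup.normalizer (half b) := by
    have := Subgroup.le_normalizer_map (H := (restrict α₀ α₁ [b]).ker)
      (ψ.comp SemidirectProduct.inl)
    rwa [Subgroup.normalizer_eq_top, ← MonoidHom.range_eq_map] at this
  have hcomm : ∀ x ∈ half false, ∀ y ∈ half true, Commute x y := by
    rintro _ ⟨x, hx, rfl⟩ _ ⟨y, hy, rfl⟩
    exact (commute_of_restrict_eq_one hx hy).map _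
  have hbot : ∃ b, ∀ k, restrict α₀ α₁ [b] k = 1 → ψ (.inl k) = 1 := by
    rcases eq_bot_or_eq_bot_of_commute hM (hle _) (hle _) (hnorm _) (hnorm _) hcomm with h | h
    exacts [⟨false, (Subgroup.map_eq_bot_iff _).1 h⟩, ⟨true, (Subgroup.map_eq_bot_iff _).1 h⟩]
  obtain ⟨b, hb⟩ := hbot
  have hb' := map_inl_eq_one_of_restrict hb
  obtain ⟨x, y, hx, hy, rfl⟩ := exists_mul_of_restrict_eq_one k
  rw [map_mul, map_mul]
  cases b
  · rw [hb x hx, hb' y hy, one_mul]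
  · rw [hb' x hx, hb y hy, one_mul]

end Kernel

section Isomorphism

variable {Γ Λ : Type*} [Group Γ] [Group Λ] {α₀ α₁ : Γ →* Γ} {β₀ β₁ : Λ →* Λ} {m : List Bool}

theorem exists_swapGroup_le_of_jonesStabilizer_le (hm : wordEnd α₀ α₁ m = 1)
    {k : LimitGroup α₀ α₁} {A : Subgroup ThompsonV}
    (hkA : jonesStabilizer k ≤ Subgroup.normalizer A) (hA : A ≠ ⊥) :
    ∃ c, restrict α₀ α₁ c k = 1 ∧ swapGroup c ≤ A := by
  obtain ⟨a, ha, ha₁⟩ := A.bot_or_exists_ne_one.resolve_left hA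
  obtain ⟨c, hc⟩ := exists_disjoint_smul_cone ha₁
  obtain ⟨e, he⟩ := exists_restrict_append_eq_one hm k c
  have hce : cone (c ++ e) ⊆ cone c := cone_anti (c.prefix_append e)
  exact ⟨c ++ e, he, swapGroup_le_of_disjoint_smul ha (hc.mono (Set.smul_set_mono hce) hce)
    ((swapGroup_le_jonesStabilizer he).trans hkA)⟩

theorem exists_not_commute_of_jonesStabilizer_le (hm : wordEnd α₀ α₁ m = 1)
    {k : LimitGroup α₀ α₁} {A B : Subgroup ThompsonV}
    (hkA : jonesStabilizer k ≤ Subgroup.normalizer A)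
    (hkB : jonesStabilizer k ≤ Subgroup.normalizer B) (hA : A ≠ ⊥) (hB : B ≠ ⊥) :
    ∃ x ∈ A, ∃ y ∈ B, ¬ Commute x y := by
  obtain ⟨c, hc, hcA⟩ := exists_swapGroup_le_of_jonesStabilizer_le hm hkA hA
  obtain ⟨d, hd, hdB⟩ := exists_swapGroup_le_of_jonesStabilizer_le hm hkB hB
  refine exists_not_commute_of_swapGroup_le hcA hdB fun h => ⟨coneSwap c d h, hkA ?_, [], ?_⟩
  · exact (jonesAction_coneSwap_eq_self_iff h).2 (hc.trans hd.symm)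
  · rw [List.append_nil]
    exact mapsCone_coneSwap_left h

theorem mem_normalizer_fixingSubgroup {v : ThompsonV} {S : Set Cantor} (hv : v • S = S) :
    v ∈ Subgroup.normalizer (fixingSubgroup ThompsonV S) :=
  Subgroup.mem_normalizer_iff.2 fun f => by
    refine ⟨Set.conj_mem_fixingSubgroup hv, fun hf => ?_⟩
    simpa [mul_assoc] using Set.conj_mem_fixingSubgroup (inv_smul_eq_iff.2 hv.symm) hf

theorem exists_mem_jonesStabilizer_smul_ne (hm : wordEnd α₀ α₁ m = 1) (k : LimitGroup α₀ α₁)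
    (κ : ThompsonV ≃* ThompsonV) {S : Set Cantor} (hS : fixingSubgroup ThompsonV S ≠ ⊥)
    (hSc : fixingSubgroup ThompsonV Sᶜ ≠ ⊥) : ∃ v ∈ jonesStabilizer k, κ v • S ≠ S := by
  by_contra! h
  let pre (T : Set Cantor) := (fixingSubgroup ThompsonV T).comap κ.toMonoidHom
  have hnorm {T} (hT : ∀ v ∈ jonesStabilizer k, κ v • T = T) :
      jonesStabilizer k ≤ Subgroup.normalizer (pre T) := fun v hv =>
    Subgroup.le_normalizer_comap κ.toMonoidHom (mem_normalizer_fixingSubgroup (hT v hv))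
  have hpre {T} (hT : fixingSubgroup ThompsonV T ≠ ⊥) : pre T ≠ ⊥ := fun h =>
    hT <| (Subgroup.comap_injective κ.surjective) <| h.trans <|
      ((MonoidHom.ker_eq_bot_iff κ.toMonoidHom).2 κ.injective).symm
  obtain ⟨x, hx, y, hy, hxy⟩ := exists_not_commute_of_jonesStabilizer_le hm (hnorm h)
    (hnorm fun v hv => by rw [Set.smul_set_compl, h v hv]) (hpre hS) (hpre hSc)
  exact hxy <| (commute_of_mem_fixingSubgroup hx hy (Set.union_compl_self S)).of_map κ.injective

theorem fixingSubgroup_ne_bot_of_disjoint {S : Set Cantor} {c : List Bool}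
    (hS : Disjoint S (cone c)) : fixingSubgroup ThompsonV S ≠ ⊥ := fun h => by
  obtain ⟨x, hx, y, -, hxy⟩ := exists_not_commute_mem_swapGroup c
  have hxS : x ∈ fixingSubgroup ThompsonV S :=
    fixingSubgroup_antitone _ _ hS.subset_compl_right (swapGroup_le_fixingSubgroup c hx)
  obtain rfl : x = 1 := (Subgroup.eq_bot_iff_forall _).1 h x hxS
  exact hxy (Commute.one_left y)

theorem smul_cone_eq_of_restrict_eq_one_iff {v : ThompsonV} {x : LimitGroup β₀ β₁} {c : List Bool}
    (hx : ∀ w, restrict β₀ β₁ w x = 1 ↔ c <+: w)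
    (hv : ∀ w, restrict β₀ β₁ w (jonesAction β₀ β₁ v x) = 1 ↔ c <+: w) : v • cone c = cone c := by
  obtain ⟨n, hn⟩ := eventually_longWords.1 (eventually_exists_mapsCone v c.length)
  have hmem (y : Cantor) : y ∈ cone c ↔ v • y ∈ cone c := by
    obtain ⟨w, z, hw, rfl⟩ := exists_cat_eq (max n c.length) y
    obtain ⟨w', hw', h⟩ := hn w (by omega)
    rw [h, cat_mem_cone_iff (by omega), cat_mem_cone_iff hw', ← hx, ← hv, restrict_jonesAction h]
  ext y
  rw [Set.mem_smul_set_iff_inv_smul_mem, hmem, smul_inv_smul]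

theorem exists_map_inl_eq_inl (φ : FractionGroup α₀ α₁ ≃* FractionGroup β₀ β₁)
    (k : LimitGroup α₀ α₁) : ∃ l, φ (.inl k) = .inl l := by
  have h : φ (.inl k) ∈ (SemidirectProduct.inl : _ →* FractionGroup β₀ β₁).range := by
    rw [SemidirectProduct.range_inl_eq_ker_rightHom]
    exact map_inl_eq_one (ψ := SemidirectProduct.rightHom.comp φ.toMonoidHom)
      (SemidirectProduct.rightHom_surjective.comp φ.surjective) k
  exact h.imp fun _ => Eq.symm

theorem nontrivial_limitGroup_of_mulEquiv (φ : FractionGroup α₀ α₁ ≃* FractionGroup β₀ β₁)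
    (h : Nontrivial (LimitGroup α₀ α₁)) : Nontrivial (LimitGroup β₀ β₁) := by
  obtain ⟨k, hk⟩ := exists_ne (1 : LimitGroup α₀ α₁)
  obtain ⟨l, hl⟩ := exists_map_inl_eq_inl φ k
  refine ⟨l, 1, fun hl₁ => hk <| SemidirectProduct.inl_injective <| φ.injective ?_⟩
  rw [hl, hl₁, map_one, map_one, map_one]

/-- The endomorphism of Thompson's group through which an isomorphism of fraction groups acts on
their quotients by the limit groups. -/
def quotientHom (φ : FractionGroup α₀ α₁ ≃* FractionGroup β₀ β₁) : ThompsonV →* ThompsonV :=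
  SemidirectProduct.rightHom.comp (φ.toMonoidHom.comp SemidirectProduct.inr)

theorem rightHom_map (φ : FractionGroup α₀ α₁ ≃* FractionGroup β₀ β₁) (g : FractionGroup α₀ α₁) :
    (φ g).right = quotientHom φ g.right := by
  obtain ⟨l, hl⟩ := exists_map_inl_eq_inl φ g.left
  rw [← SemidirectProduct.inl_left_mul_inr_right g, map_mul, hl]
  simp [quotientHom]

theorem quotientHom_symm_comp (φ : FractionGroup α₀ α₁ ≃* FractionGroup β₀ β₁) :
    (quotientHom φ.symm).comp (quotientHom φ) = MonoidHom.id _ :=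
  MonoidHom.ext fun v => by
    have h := rightHom_map φ.symm (φ (.inr v))
    rw [φ.symm_apply_apply, rightHom_map φ] at h
    exact h.symm

/-- The automorphism of Thompson's group induced by an isomorphism of fraction groups. -/
def quotientEquiv (φ : FractionGroup α₀ α₁ ≃* FractionGroup β₀ β₁) : ThompsonV ≃* ThompsonV :=
  (quotientHom φ).toMulEquiv (quotientHom φ.symm) (quotientHom_symm_comp φ)
    (quotientHom_symm_comp φ.symm)

theorem exists_jonesAction_eq_conj (φ : FractionGroup α₀ α₁ ≃* FractionGroup β₀ β₁)
    {k : LimitGroup α₀ α₁} {x : LimitGroup β₀ β₁} (hk : φ (.inl k) = .inl x) {v : ThompsonV}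
    (hv : v ∈ jonesStabilizer k) : ∃ l, jonesAction β₀ β₁ (quotientEquiv φ v) x = l * x * l⁻¹ := by
  have hφ : φ (.inr v) = .inl (φ (.inr v)).left * .inr (quotientEquiv φ v) :=
    (SemidirectProduct.inl_left_mul_inr_right _).symm
  have hconj : φ (.inr v) * .inl x * (φ (.inr v))⁻¹ = .inl x := by
    rw [← hk, ← map_inv, ← map_inv, ← map_mul, ← map_mul, ← SemidirectProduct.inl_aut,
      mem_jonesStabilizer_iff.1 hv]
  generalize (φ (.inr v)).left = l at hφ
  refine ⟨l⁻¹, SemidirectProduct.inl_injective (φ := jonesAction β₀ β₁) ?_⟩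
  calc SemidirectProduct.inl (jonesAction β₀ β₁ (quotientEquiv φ v) x)
      = .inr (quotientEquiv φ v) * .inl x * (.inr (quotientEquiv φ v))⁻¹ := by
        rw [SemidirectProduct.inl_aut, map_inv]
    _ = (.inl l)⁻¹ * (φ (.inr v) * .inl x * (φ (.inr v))⁻¹) * .inl l := by rw [hφ]; group
    _ = .inl (l⁻¹ * x * l⁻¹⁻¹) := by rw [hconj, inv_inv, map_mul, map_mul, map_inv]

theorem isEmpty_mulEquiv (hm : wordEnd α₀ α₁ m = 1) (h₀ : Function.Injective β₀)
    (h₁ : Function.Injective β₁)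
    (h : Nontrivial (LimitGroup α₀ α₁) ∨ Nontrivial (LimitGroup β₀ β₁)) :
    IsEmpty (FractionGroup α₀ α₁ ≃* FractionGroup β₀ β₁) := by
  refine ⟨fun φ => ?_⟩
  obtain ⟨x, hx⟩ := exists_restrict_eq_one_iff h₀ h₁ <|
    h.elim (nontrivial_limitGroup_of_mulEquiv φ) id
  obtain ⟨k, hk⟩ := exists_map_inl_eq_inl φ.symm x
  obtain ⟨v, hv, hne⟩ := exists_mem_jonesStabilizer_smul_ne hm k (quotientEquiv φ)
    (fixingSubgroup_ne_bot_of_disjoint disjoint_cone_false_true.symm)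
    (fixingSubgroup_ne_bot_of_disjoint disjoint_compl_left)
  obtain ⟨l, hl⟩ := exists_jonesAction_eq_conj φ (φ.symm_apply_eq.1 hk).symm hv
  refine hne (smul_cone_eq_of_restrict_eq_one_iff hx fun w => ?_)
  rw [hl, map_mul, map_mul, map_inv, conj_eq_one_iff, hx]

end Isomorphism

section Equivariant

variable {Γ Λ : Type*} [Group Γ] [Group Λ] {α₀ α₁ : Γ →* Γ} {β₀ β₁ : Λ →* Λ} {m : List Bool}

theorem IsEquivariant.restrict_eq {θ : LimitGroup α₀ α₁ →* LimitGroup β₀ β₁}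
    (hθ : IsEquivariant θ) {p q : List Bool} (h : Disjoint (cone p) (cone q))
    {k : LimitGroup α₀ α₁} (hk : restrict α₀ α₁ p k = restrict α₀ α₁ q k) :
    restrict β₀ β₁ p (θ k) = restrict β₀ β₁ q (θ k) := by
  rw [← jonesAction_coneSwap_eq_self_iff h] at hk ⊢
  rw [← hθ, hk]

theorem IsEquivariant.restrict_eq_iff {θ : LimitGroup α₀ α₁ →* LimitGroup β₀ β₁}
    (hθ : IsEquivariant θ) (hinj : Function.Injective θ) {p q : List Bool}
    (h : Disjoint (cone p) (cone q)) {k : LimitGroup α₀ α₁} :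
    restrict β₀ β₁ p (θ k) = restrict β₀ β₁ q (θ k) ↔ restrict α₀ α₁ p k = restrict α₀ α₁ q k := by
  rw [← jonesAction_coneSwap_eq_self_iff h, ← jonesAction_coneSwap_eq_self_iff h, ← hθ,
    hinj.eq_iff]

theorem not_injective_of_isEquivariant (hm : wordEnd α₀ α₁ m = 1) (h₀ : Function.Injective β₀)
    (h₁ : Function.Injective β₁) (h : Nontrivial (LimitGroup β₀ β₁))
    {θ : LimitGroup β₀ β₁ →* LimitGroup α₀ α₁} (hθ : IsEquivariant θ) : ¬ Function.Injective θ := by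
  intro hinj
  obtain ⟨x, hx⟩ := exists_restrict_eq_one_iff h₀ h₁ h
  obtain ⟨e, he⟩ := exists_restrict_append_eq_one hm (θ x) [false]
  obtain ⟨f, hf⟩ := exists_restrict_append_eq_one hm (θ x) [true]
  have hef := (hθ.restrict_eq_iff hinj (disjoint_cone_append disjoint_cone_false_true e f)).1
    (he.trans hf.symm)
  simpa using (hx _).1 (hef.trans ((hx _).2 ([true].prefix_append f)))

theorem exists_cone_disjoint_disjoint {w w' : List Bool} (hw : 2 ≤ w.length) (hw' : 2 ≤ w'.length)
    (n : ℕ) : ∃ u, n ≤ u.length ∧ Disjoint (cone w) (cone u) ∧ Disjoint (cone u) (cone w') := by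
  match w, w', hw, hw' with
  | a :: b :: w, c :: d :: w', _, _ =>
    refine ⟨(!a) :: (!d) :: List.replicate n true, ?_, ?_, ?_⟩ <;> simp [disjoint_cone_iff]
    omega

theorem exists_restrict_eq_of_isEquivariant (hm : wordEnd α₀ α₁ m = 1)
    (h₀ : Function.Injective β₀) (h₁ : Function.Injective β₁)
    {θ : LimitGroup α₀ α₁ →* LimitGroup β₀ β₁} (hθ : IsEquivariant θ) (k : LimitGroup α₀ α₁) :
    ∃ n, ∀ w w' : List Bool, n ≤ w.length → n ≤ w'.length →
      restrict β₀ β₁ w (θ k) = restrict β₀ β₁ w' (θ k) := by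
  obtain ⟨n, hn⟩ := eventually_longWords.1 (eventually_restrict_append_eq_one hm k)
  obtain ⟨n', hn'⟩ := exists_restrict_eq_of_append h₀ h₁ (θ k)
  have hdisj {w w' : List Bool} (hw : max n n' ≤ w.length) (hw' : max n n' ≤ w'.length)
      (h : Disjoint (cone w) (cone w')) :
      restrict β₀ β₁ w (θ k) = restrict β₀ β₁ w' (θ k) :=
    hn' w w' m (by omega) (by omega) <| hθ.restrict_eq (disjoint_cone_append h m m) <|
      (hn w (by omega)).trans (hn w' (by omega)).symm
  refine ⟨max n n' + 2, fun w w' hw hw' => ?_⟩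
  obtain ⟨u, hu, hwu, huw'⟩ := exists_cone_disjoint_disjoint (w := w) (w' := w') (by omega)
    (by omega) (max n n')
  exact (hdisj (by omega) hu hwu).trans (hdisj hu (by omega) huw')

theorem jonesAction_map_of_isEquivariant (hm : wordEnd α₀ α₁ m = 1) (h₀ : Function.Injective β₀)
    (h₁ : Function.Injective β₁) {θ : LimitGroup α₀ α₁ →* LimitGroup β₀ β₁} (hθ : IsEquivariant θ)
    (v : ThompsonV) (k : LimitGroup α₀ α₁) : jonesAction β₀ β₁ v (θ k) = θ k := by
  obtain ⟨n, hn⟩ := exists_restrict_eq_of_isEquivariant hm h₀ h₁ hθ k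
  refine jonesAction_eq_self_of_eventually ?_
  filter_upwards [eventually_exists_mapsCone v n, eventually_length_ge n] with w ⟨w', hw', hv⟩ hw
  exact ⟨w', hv, hn w w' hw hw'⟩

theorem eq_one_of_forall_jonesAction_eq (hm : wordEnd α₀ α₁ m = 1) {k : LimitGroup α₀ α₁}
    (hk : ∀ v, jonesAction α₀ α₁ v k = k) : k = 1 := by
  refine eq_of_eventually_restrict_eq ((eventually_length_ge 1).mono fun w hw => ?_)
  obtain ⟨b, u, rfl⟩ := List.exists_cons_of_length_pos hw
  obtain ⟨e, he⟩ := exists_restrict_append_eq_one hm k [!b]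
  have hdisj : Disjoint (cone (b :: u)) (cone ([!b] ++ e)) := by simp [disjoint_cone_iff]
  rw [(jonesAction_coneSwap_eq_self_iff hdisj).1 (hk _), he, map_one]

end Equivariant

end FractionGroups

end

theorem theoremB_general {Γ Λ : Type*} [Group Γ] [Group Λ] {α₀ α₁ : Γ →* Γ} {m : List Bool}
    (hm : FractionGroups.wordEnd α₀ α₁ m = 1) (β₀ β₁ : Λ →* Λ)
    (hβ₀ : Function.Injective β₀) (hβ₁ : Function.Injective β₁) :
    ((Nontrivial (FractionGroups.LimitGroup α₀ α₁) ∨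
        Nontrivial (FractionGroups.LimitGroup β₀ β₁)) →
      IsEmpty (FractionGroups.FractionGroup α₀ α₁ ≃* FractionGroups.FractionGroup β₀ β₁)) ∧
    (Nontrivial (FractionGroups.LimitGroup β₀ β₁) →
      ¬ ∃ θ : FractionGroups.LimitGroup β₀ β₁ →* FractionGroups.LimitGroup α₀ α₁,
        FractionGroups.IsEquivariant θ ∧ Function.Injective θ) ∧
    ((∀ θ : FractionGroups.LimitGroup α₀ α₁ →* FractionGroups.LimitGroup β₀ β₁,
        FractionGroups.IsEquivariant θ →
          ∀ (v : FractionGroups.ThompsonV) (a : FractionGroups.LimitGroup α₀ α₁),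
            FractionGroups.jonesAction β₀ β₁ v (θ a) = θ a) ∧
      (Nontrivial (FractionGroups.LimitGroup α₀ α₁) →
        ¬ ∃ θ : FractionGroups.LimitGroup α₀ α₁ →* FractionGroups.LimitGroup β₀ β₁,
          FractionGroups.IsEquivariant θ ∧ Function.Injective θ)) := by
  open FractionGroups in
  refine ⟨isEmpty_mulEquiv hm hβ₀ hβ₁, ?_, ?_, ?_⟩
  · rintro hL ⟨θ, hθ, hinj⟩
    exact not_injective_of_isEquivariant hm hβ₀ hβ₁ hL hθ hinj
  · exact fun θ hθ => jonesAction_map_of_isEquivariant hm hβ₀ hβ₁ hθ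
  · rintro hK ⟨θ, hθ, hinj⟩
    obtain ⟨a, ha⟩ := exists_ne (1 : LimitGroup α₀ α₁)
    refine ha (eq_one_of_forall_jonesAction_eq hm fun v => hinj ?_)
    rw [hθ, jonesAction_map_of_isEquivariant hm hβ₀ hβ₁ hθ]

theorem theoremB {Γ Λ : Type*} [Group Γ] [Group Λ] (α : Γ →* Γ) (β₀ β₁ : Λ →* Λ)
    (hβ₀ : Function.Injective β₀) (hβ₁ : Function.Injective β₁) :
    ((Nontrivial (FractionGroups.LimitGroup α 1) ∨ Nontrivial (FractionGroups.LimitGroup β₀ β₁)) →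
      IsEmpty (FractionGroups.FractionGroup α 1 ≃* FractionGroups.FractionGroup β₀ β₁)) ∧
    (Nontrivial (FractionGroups.LimitGroup β₀ β₁) →
      ¬ ∃ θ : FractionGroups.LimitGroup β₀ β₁ →* FractionGroups.LimitGroup α 1,
        FractionGroups.IsEquivariant θ ∧ Function.Injective θ) ∧
    ((∀ θ : FractionGroups.LimitGroup α 1 →* FractionGroups.LimitGroup β₀ β₁,
        FractionGroups.IsEquivariant θ →
          ∀ (v : FractionGroups.ThompsonV) (a : FractionGroups.LimitGroup α 1),
            FractionGroups.jonesAction β₀ β₁ v (θ a) = θ a) ∧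
      (Nontrivial (FractionGroups.LimitGroup α 1) →
        ¬ ∃ θ : FractionGroups.LimitGroup α 1 →* FractionGroups.LimitGroup β₀ β₁,
          FractionGroups.IsEquivariant θ ∧ Function.Injective θ)) := by
  exact theoremB_general (m := [true]) (MonoidHom.ext fun _ => rfl) β₀ β₁ hβ₀ hβ₁
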